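/- Let $A\in\mathbb{R}^{n\times n}$ and $B\in\mathbb{R}^{n\times 1}$ be such that $(A,B)$ is controllable and $A$ is unstable, i.e. at least one eigenvalue of $A$ has absolute value larger than $1$. Let $\lambda_0,\dots,\lambda_{n-1}\in\mathbb{C}$ be the eigenvalues of $A$, repeated according to algebraic multiplicity. Let $(\theta_{2,k})_{k\ge 0}$ be an i.i.d. process with values in $\{0,1\}$ on a probability space, with loss probability $\alpha_2=\mathrm{Prob}\{\theta_{2,k}=0\}\in[0,1]$. For a gain $F\in\mathbb{R}^{1\times n}$ consider the closed-loop system \[ x_{k+1}=Ax_k+Bu_k,\qquad u_k=\theta_{2,k}Fx_k,\qquad k\ge 0, \] and call it stochastically stable if $\mathbb{E}\bigl[\sum_{k=0}^{\infty}|x_k|^2\bigr]<\infty$ for every initial condition $x_0\in\mathbb{R}^n$, where $|\cdot|$ is the Euclidean norm. Then there exists a gain $F\in\mathbb{R}^{1\times n}$ such that the closed-loop system is stochastically stable if and only if \[ \alpha_2<\frac{1}{\prod_{|\lambda_i|>1}|\lambda_i|^2}. \] -/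

import Mathlib

open MeasureTheory ProbabilityTheory
open scoped Matrix

noncomputable section

namespace LossyControl

/-- The eigenvalues `λ_0, …, λ_{n-1}` of a real square matrix: the complex roots of its
characteristic polynomial, listed with algebraic multiplicity. -/
def eigenvalues {n : ℕ} (A : Matrix (Fin n) (Fin n) ℝ) : Multiset ℂ :=
  (A.map (algebraMap ℝ ℂ)).charpoly.roots

/-- `A` is unstable: at least one eigenvalue has absolute value larger than `1`. -/
def IsUnstable {n : ℕ} (A : Matrix (Fin n) (Fin n) ℝ) : Prop :=
  ∃ z ∈ eigenvalues A, 1 < ‖z‖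

/-- The product of `|λ_i| ^ 2` over the eigenvalues with `|λ_i| > 1`, with multiplicity. -/
def unstableProd {n : ℕ} (A : Matrix (Fin n) (Fin n) ℝ) : ℝ :=
  (((eigenvalues A).filter fun z => 1 < ‖z‖).map fun z => ‖z‖ ^ 2).prod

/-- The controllability matrix `[B, A B, …, A ^ (n - 1) B]`. The column with index `(j, l)` is
column `l` of `A ^ j B`. -/
def controllabilityMatrix {n m : ℕ} (A : Matrix (Fin n) (Fin n) ℝ)
    (B : Matrix (Fin n) (Fin m) ℝ) : Matrix (Fin n) (Fin n × Fin m) ℝ :=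
  Matrix.of fun i j => (A ^ (j.1 : ℕ) * B) i j.2

/-- The pair `(A, B)` is controllable: the controllability matrix has full rank. -/
def IsControllable {n m : ℕ} (A : Matrix (Fin n) (Fin n) ℝ)
    (B : Matrix (Fin n) (Fin m) ℝ) : Prop :=
  (controllabilityMatrix A B).rank = n

/-- `θ` is an i.i.d. Bernoulli process with values in `{0, 1}`, where `θ k = 0` means that the
message at time `k` is lost, and `α` is the loss probability. -/
structure IsLossProcess {Ω : Type*} [MeasurableSpace Ω] (μ : Measure Ω) (α : ℝ)
    (θ : ℕ → Ω → ℝ) : Prop where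
  measurable : ∀ k, Measurable (θ k)
  zero_or_one : ∀ k ω, θ k ω = 0 ∨ θ k ω = 1
  indep : iIndepFun θ μ
  loss_prob : ∀ k, μ.real {ω | θ k ω = 0} = α

/-- The state of the closed loop of the plant `x_{k+1} = A x_k + B u_k` with the state feedback
`u_k = θ_k F x_k` received over the lossy channel, started at `x₀`. -/
def closedLoopState {n m : ℕ} {Ω : Type*} (A : Matrix (Fin n) (Fin n) ℝ)
    (B : Matrix (Fin n) (Fin m) ℝ) (F : Matrix (Fin m) (Fin n) ℝ) (θ : ℕ → Ω → ℝ)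
    (x₀ : Fin n → ℝ) : ℕ → Ω → (Fin n → ℝ)
  | 0 => fun _ => x₀
  | k + 1 => fun ω =>
      A *ᵥ closedLoopState A B F θ x₀ k ω +
        B *ᵥ (θ k ω • (F *ᵥ closedLoopState A B F θ x₀ k ω))

/-- Stochastic stability of the closed loop: for every initial condition, the expectation of
`∑ k, |x_k| ^ 2` is finite, where `|·|` is the Euclidean norm. -/
def StochasticallyStable {n m : ℕ} {Ω : Type*} [MeasurableSpace Ω] (μ : Measure Ω)
    (A : Matrix (Fin n) (Fin n) ℝ) (B : Matrix (Fin n) (Fin m) ℝ)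
    (F : Matrix (Fin m) (Fin n) ℝ) (θ : ℕ → Ω → ℝ) : Prop :=
  ∀ x₀ : Fin n → ℝ,
    ∫⁻ ω, ∑' k, ‖WithLp.toLp 2 (closedLoopState A B F θ x₀ k ω)‖ₑ ^ 2 ∂μ < ⊤

end LossyControl

end

/-! Write G = A + BF and L(P) = α AᵀPA + (1 - α) GᵀPG (`meanOp`). Since x_k is independent of θ_k,
the expectation of `quad P` at x_k is `quad (L^k P)` at x₀. Stability is thus convergence of the
series of L^k(1), and probability disappears (`stochasticallyStable_iff_summable`). Split A into a
block A₁ with eigenvalues of modulus at least 1 and a block A₂ with the others; the product in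
question is (det A₁)².

Necessity (`mul_det_sq_lt_one`): the sum P of the series satisfies P = L(P) + 1, so L(P) < P. As the
input is scalar, completing the square bounds L(P) below, whatever F, by a form involving only a
rank-one correction of P. On the A₁-subspace the matrix determinant lemma and Cauchy–Schwarz give
that form a determinant at least α (det A₁)² times that of P, while monotonicity of the determinant
makes it smaller than that of P.

Sufficiency: for an antistable pair the inverse P of the backward Gramian solves the Riccati
equation P = AᵀPA - AᵀPbbᵀPA / (1 + bᵀPb), with 1 + bᵀPb = (det A)² (`exists_inverse_gramian`). The
minimizing gain then gives L(P) ≤ P as soon as α (det A)² ≤ 1. Rescaling A turns this into a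
contraction and admits the unit circle; the stable block, driven by the first, is absorbed by a
weighted Lyapunov function. -/

namespace LossyControl

/-- The quadratic form `x ↦ xᵀ P x`. -/
def quad {ι : Type*} [Fintype ι] (P : Matrix ι ι ℝ) (x : ι → ℝ) : ℝ := x ⬝ᵥ P *ᵥ x

/-! ### Quadratic forms and the mean cost operator -/

section Quad

variable {ι κ : Type*} [Fintype ι] [Fintype κ]

theorem quad_conj (P : Matrix ι ι ℝ) (G : Matrix ι κ ℝ) (x : κ → ℝ) :
    quad (Gᵀ * P * G) x = quad P (G *ᵥ x) := by
  simp only [quad, ← Matrix.mulVec_mulVec]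
  rw [Matrix.dotProduct_mulVec, Matrix.vecMul_transpose]

theorem quad_add (P Q : Matrix ι ι ℝ) (x : ι → ℝ) : quad (P + Q) x = quad P x + quad Q x := by
  simp [quad, Matrix.add_mulVec]

theorem quad_sub (P Q : Matrix ι ι ℝ) (x : ι → ℝ) : quad (P - Q) x = quad P x - quad Q x := by
  simp [quad, Matrix.sub_mulVec]

theorem quad_smul (c : ℝ) (P : Matrix ι ι ℝ) (x : ι → ℝ) : quad (c • P) x = c * quad P x := by
  simp [quad, Matrix.smul_mulVec]

theorem quad_smul_vec (c : ℝ) (P : Matrix ι ι ℝ) (x : ι → ℝ) :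
    quad P (c • x) = c ^ 2 * quad P x := by
  simp only [quad, Matrix.mulVec_smul, dotProduct_smul, smul_dotProduct, smul_eq_mul]
  ring

theorem quad_one [DecidableEq ι] (x : ι → ℝ) : quad 1 x = x ⬝ᵥ x := by
  simp [quad]

theorem quad_one_nonneg [DecidableEq ι] (x : ι → ℝ) : 0 ≤ quad 1 x := by
  rw [quad_one]
  exact Finset.sum_nonneg fun i _ => mul_self_nonneg _

theorem measurable_quad (P : Matrix ι ι ℝ) : Measurable (quad P) := by
  have : Continuous (quad P) := by unfold quad; fun_prop
  exact this.measurable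

/-- The operator `P ↦ α Aᵀ P A + (1 - α) Gᵀ P G` propagating quadratic costs backwards in time. -/
def meanOp (α : ℝ) (A G P : Matrix ι ι ℝ) : Matrix ι ι ℝ :=
  α • (Aᵀ * P * A) + (1 - α) • (Gᵀ * P * G)

theorem quad_meanOp (α : ℝ) (A G P : Matrix ι ι ℝ) (x : ι → ℝ) :
    quad (meanOp α A G P) x = α * quad P (A *ᵥ x) + (1 - α) * quad P (G *ᵥ x) := by
  simp [meanOp, quad_add, quad_smul, quad_conj]

theorem quad_meanOp_nonneg {α : ℝ} (h0 : 0 ≤ α) (h1 : α ≤ 1) (A G : Matrix ι ι ℝ)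
    {P : Matrix ι ι ℝ} (hP : ∀ x, 0 ≤ quad P x) (x : ι → ℝ) : 0 ≤ quad (meanOp α A G P) x := by
  rw [quad_meanOp]
  exact add_nonneg (mul_nonneg h0 (hP _)) (mul_nonneg (by linarith) (hP _))

theorem quad_iterate_meanOp_nonneg {α : ℝ} (h0 : 0 ≤ α) (h1 : α ≤ 1) (A G : Matrix ι ι ℝ)
    {P : Matrix ι ι ℝ} (hP : ∀ x, 0 ≤ quad P x) (k : ℕ) (x : ι → ℝ) :
    0 ≤ quad ((meanOp α A G)^[k] P) x := by
  induction k generalizing x with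
  | zero => exact hP x
  | succ k ih =>
    rw [Function.iterate_succ_apply']
    exact quad_meanOp_nonneg h0 h1 A G ih x

end Quad

/-! ### Second moments of the closed loop -/

section ClosedLoop

variable {n m : ℕ} {Ω : Type*} {α : ℝ} {θ : ℕ → Ω → ℝ}

theorem closedLoopState_succ_of_zero (A : Matrix (Fin n) (Fin n) ℝ) (B : Matrix (Fin n) (Fin m) ℝ)
    (F : Matrix (Fin m) (Fin n) ℝ) (x₀ : Fin n → ℝ) {k : ℕ} {ω : Ω} (h : θ k ω = 0) :
    closedLoopState A B F θ x₀ (k + 1) ω = A *ᵥ closedLoopState A B F θ x₀ k ω := by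
  simp [closedLoopState, h]

theorem closedLoopState_succ_of_one (A : Matrix (Fin n) (Fin n) ℝ) (B : Matrix (Fin n) (Fin m) ℝ)
    (F : Matrix (Fin m) (Fin n) ℝ) (x₀ : Fin n → ℝ) {k : ℕ} {ω : Ω} (h : θ k ω = 1) :
    closedLoopState A B F θ x₀ (k + 1) ω = (A + B * F) *ᵥ closedLoopState A B F θ x₀ k ω := by
  simp [closedLoopState, h, Matrix.add_mulVec]

/-- The strict bound in `Set.Iio k` matters: x_k uses only channel values before time k, hence is
independent of θ_k. -/
theorem measurable_closedLoopState_past (A : Matrix (Fin n) (Fin n) ℝ)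
    (B : Matrix (Fin n) (Fin m) ℝ) (F : Matrix (Fin m) (Fin n) ℝ) (θ : ℕ → Ω → ℝ)
    (x₀ : Fin n → ℝ) (k : ℕ) :
    Measurable[⨆ i ∈ Set.Iio k, MeasurableSpace.comap (θ i) inferInstance]
      (closedLoopState A B F θ x₀ k) := by
  induction k with
  | zero => exact measurable_const
  | succ k ih =>
    have hle : (⨆ i ∈ Set.Iio k, MeasurableSpace.comap (θ i) inferInstance) ≤
        ⨆ i ∈ Set.Iio (k + 1), MeasurableSpace.comap (θ i) inferInstance :=
      biSup_mono fun i hi => lt_trans hi (Nat.lt_succ_self k)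
    have h1 := ih.mono hle le_rfl
    have h2 : Measurable[⨆ i ∈ Set.Iio (k + 1), MeasurableSpace.comap (θ i) inferInstance] (θ k) :=
      Measurable.mono (comap_measurable (θ k))
        (le_biSup (fun i => MeasurableSpace.comap (θ i) inferInstance)
          (Set.mem_Iio.2 (Nat.lt_succ_self k))) le_rfl
    have hc : Continuous fun p : (Fin n → ℝ) × ℝ => A *ᵥ p.1 + B *ᵥ (p.2 • (F *ᵥ p.1)) := by
      fun_prop
    exact hc.measurable.comp (h1.prodMk h2)

theorem measurable_indicator_one {m : MeasurableSpace Ω} {t : Set Ω} (ht : MeasurableSet t) :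
    Measurable (t.indicator (1 : Ω → ENNReal)) :=
  measurable_one.indicator ht

variable [mΩ : MeasurableSpace Ω] {μ : Measure Ω}

theorem measurable_closedLoopState (hθ : ∀ k, Measurable (θ k)) (A : Matrix (Fin n) (Fin n) ℝ)
    (B : Matrix (Fin n) (Fin m) ℝ) (F : Matrix (Fin m) (Fin n) ℝ)
    (x₀ : Fin n → ℝ) (k : ℕ) : Measurable (closedLoopState A B F θ x₀ k) :=
  (measurable_closedLoopState_past A B F θ x₀ k).mono
    (iSup₂_le fun i _ => (hθ i).comap_le) le_rfl

/-- The state at time `k` is independent of the channel at time `k`. -/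
theorem lintegral_indicator_mul_closedLoopState (hθ : IsLossProcess μ α θ)
    (A : Matrix (Fin n) (Fin n) ℝ) (B : Matrix (Fin n) (Fin m) ℝ) (F : Matrix (Fin m) (Fin n) ℝ)
    (x₀ : Fin n → ℝ) (k : ℕ) (s : Set ℝ) (hs : MeasurableSet s)
    (f : (Fin n → ℝ) → ENNReal) (hf : Measurable f) :
    ∫⁻ ω, (θ k ⁻¹' s).indicator 1 ω * f (closedLoopState A B F θ x₀ k ω) ∂μ =
      μ (θ k ⁻¹' s) * ∫⁻ ω, f (closedLoopState A B F θ x₀ k ω) ∂μ := by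
  have hm : ∀ i, MeasurableSpace.comap (θ i) inferInstance ≤ mΩ := fun i =>
    (hθ.measurable i).comap_le
  have hind := indep_iSup_of_disjoint hm hθ.indep (S := {k}) (T := Set.Iio k) (by simp)
  have hset : MeasurableSet (θ k ⁻¹' s) := hθ.measurable k hs
  have hpast : Measurable[⨆ i ∈ ({k} : Set ℕ), MeasurableSpace.comap (θ i) inferInstance]
      ((θ k ⁻¹' s).indicator (1 : Ω → ENNReal)) := by
    refine measurable_indicator_one ?_
    exact le_biSup (fun i => MeasurableSpace.comap (θ i) inferInstance) (Set.mem_singleton k) _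
      ⟨s, hs, rfl⟩
  have := lintegral_mul_eq_lintegral_mul_lintegral_of_independent_measurableSpace
    (iSup₂_le fun i _ => hm i) (iSup₂_le fun i _ => hm i) hind
    (f := (θ k ⁻¹' s).indicator 1) (g := fun ω => f (closedLoopState A B F θ x₀ k ω))
    hpast (hf.comp (measurable_closedLoopState_past A B F θ x₀ k))
  rw [this, lintegral_indicator_one hset]

theorem lintegral_quad_closedLoopState_succ [IsProbabilityMeasure μ] (hθ : IsLossProcess μ α θ)
    (h0 : 0 ≤ α) (h1 : α ≤ 1)
    (A : Matrix (Fin n) (Fin n) ℝ) (B : Matrix (Fin n) (Fin m) ℝ) (F : Matrix (Fin m) (Fin n) ℝ)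
    (x₀ : Fin n → ℝ) (k : ℕ) (P : Matrix (Fin n) (Fin n) ℝ) (hP : ∀ x, 0 ≤ quad P x) :
    ∫⁻ ω, ENNReal.ofReal (quad P (closedLoopState A B F θ x₀ (k + 1) ω)) ∂μ =
      ∫⁻ ω, ENNReal.ofReal
        (quad (meanOp α A (A + B * F) P) (closedLoopState A B F θ x₀ k ω)) ∂μ := by
  have hx := measurable_closedLoopState hθ.measurable A B F x₀ k
  have hq : ∀ G : Matrix (Fin n) (Fin n) ℝ,
      Measurable fun x : Fin n → ℝ => ENNReal.ofReal (quad P (G *ᵥ x)) := fun G => by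
    have : Measurable fun x : Fin n → ℝ => G *ᵥ x := by
      have : Continuous fun x : Fin n → ℝ => G *ᵥ x := by fun_prop
      exact this.measurable
    exact ENNReal.measurable_ofReal.comp ((measurable_quad P).comp this)
  have hsplit : ∀ ω, ENNReal.ofReal (quad P (closedLoopState A B F θ x₀ (k + 1) ω)) =
      (θ k ⁻¹' {0}).indicator 1 ω *
          ENNReal.ofReal (quad P (A *ᵥ closedLoopState A B F θ x₀ k ω)) +
        (θ k ⁻¹' {0}ᶜ).indicator 1 ω *
          ENNReal.ofReal (quad P ((A + B * F) *ᵥ closedLoopState A B F θ x₀ k ω)) := fun ω => by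
    rcases hθ.zero_or_one k ω with h | h
    · rw [closedLoopState_succ_of_zero A B F x₀ h]
      simp [h]
    · rw [closedLoopState_succ_of_one A B F x₀ h]
      simp [h]
  have hμ0 : μ (θ k ⁻¹' {0}) = ENNReal.ofReal α := by
    rw [← hθ.loss_prob k, ofReal_measureReal]
    rfl
  have hμ1 : μ (θ k ⁻¹' {0}ᶜ) = ENNReal.ofReal (1 - α) := by
    rw [Set.preimage_compl, prob_compl_eq_one_sub (hθ.measurable k (measurableSet_singleton 0)),
      hμ0, ENNReal.ofReal_sub _ h0, ENNReal.ofReal_one]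
  have hqx : ∀ G : Matrix (Fin n) (Fin n) ℝ, Measurable fun ω =>
      ENNReal.ofReal (quad P (G *ᵥ closedLoopState A B F θ x₀ k ω)) := fun G => (hq G).comp hx
  have hleft : Measurable fun ω => (θ k ⁻¹' {0}).indicator 1 ω *
      ENNReal.ofReal (quad P (A *ᵥ closedLoopState A B F θ x₀ k ω)) :=
    (measurable_indicator_one (hθ.measurable k (measurableSet_singleton 0))).mul (hqx A)
  simp_rw [hsplit]
  rw [lintegral_add_left hleft,
    lintegral_indicator_mul_closedLoopState hθ A B F x₀ k {0} (measurableSet_singleton 0) _ (hq A),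
    lintegral_indicator_mul_closedLoopState hθ A B F x₀ k {0}ᶜ (measurableSet_singleton 0).compl _
      (hq (A + B * F)), hμ0, hμ1]
  simp_rw [quad_meanOp]
  rw [← lintegral_const_mul _ (hqx A), ← lintegral_const_mul _ (hqx (A + B * F)),
    ← lintegral_add_left ((hqx A).const_mul _)]
  refine lintegral_congr fun ω => ?_
  rw [ENNReal.ofReal_add (mul_nonneg h0 (hP _)) (mul_nonneg (by linarith) (hP _)),
    ENNReal.ofReal_mul h0, ENNReal.ofReal_mul (by linarith)]

theorem lintegral_quad_closedLoopState [IsProbabilityMeasure μ] (hθ : IsLossProcess μ α θ)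
    (h0 : 0 ≤ α) (h1 : α ≤ 1)
    (A : Matrix (Fin n) (Fin n) ℝ) (B : Matrix (Fin n) (Fin m) ℝ) (F : Matrix (Fin m) (Fin n) ℝ)
    (x₀ : Fin n → ℝ) (k : ℕ) (P : Matrix (Fin n) (Fin n) ℝ) (hP : ∀ x, 0 ≤ quad P x) :
    ∫⁻ ω, ENNReal.ofReal (quad P (closedLoopState A B F θ x₀ k ω)) ∂μ =
      ENNReal.ofReal (quad ((meanOp α A (A + B * F))^[k] P) x₀) := by
  -- P varies because each step back in time replaces it by `meanOp` of it.
  induction k generalizing P with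
  | zero => simp [closedLoopState]
  | succ k ih =>
    rw [lintegral_quad_closedLoopState_succ hθ h0 h1 A B F x₀ k P hP,
      ih _ (quad_meanOp_nonneg h0 h1 A _ hP), Function.iterate_succ_apply]

theorem IsLossProcess.nonneg (hθ : IsLossProcess μ α θ) : 0 ≤ α := by
  rw [← hθ.loss_prob 0]
  exact measureReal_nonneg

theorem IsLossProcess.le_one [IsProbabilityMeasure μ] (hθ : IsLossProcess μ α θ) : α ≤ 1 := by
  rw [← hθ.loss_prob 0]
  exact measureReal_le_one

/-- Tonelli exchanges expectation and sum; all terms are nonnegative, so finiteness in [0, ∞] is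
summability. -/
theorem stochasticallyStable_iff_summable [IsProbabilityMeasure μ] (hθ : IsLossProcess μ α θ)
    (A : Matrix (Fin n) (Fin n) ℝ) (B : Matrix (Fin n) (Fin m) ℝ)
    (F : Matrix (Fin m) (Fin n) ℝ) :
    StochasticallyStable μ A B F θ ↔
      ∀ x, Summable fun k => quad ((meanOp α A (A + B * F))^[k] 1) x := by
  have hnorm : ∀ x : Fin n → ℝ, ‖WithLp.toLp 2 x‖ₑ ^ 2 = ENNReal.ofReal (quad 1 x) := fun x => by
    rw [← ofReal_norm, ← ENNReal.ofReal_pow (norm_nonneg _),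
      EuclideanSpace.real_norm_sq_eq, quad_one]
    simp [dotProduct, sq]
  refine forall_congr' fun x => ?_
  simp_rw [hnorm]
  have hmeas : ∀ k, Measurable fun ω => ENNReal.ofReal (quad 1 (closedLoopState A B F θ x k ω)) :=
    fun k => ENNReal.measurable_ofReal.comp ((measurable_quad 1).comp
      (measurable_closedLoopState hθ.measurable A B F x k))
  rw [lintegral_tsum fun k => (hmeas k).aemeasurable]
  simp_rw [lintegral_quad_closedLoopState hθ hθ.nonneg hθ.le_one A B F x _ 1 quad_one_nonneg]
  have hnn := fun k => quad_iterate_meanOp_nonneg hθ.nonneg hθ.le_one A (A + B * F)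
    quad_one_nonneg k x
  refine ⟨fun h => ?_, fun h => h.tsum_ofReal_lt_top⟩
  refine (ENNReal.summable_toReal h.ne).congr fun k => ?_
  rw [ENNReal.toReal_ofReal (hnn k)]

end ClosedLoop

/-! ### Comparison of quadratic forms and of determinants -/

theorem exists_quad_le {ι : Type*} [Fintype ι] {P : Matrix ι ι ℝ} (hP : ∀ x, x ≠ 0 → 0 < quad P x)
    (Q : Matrix ι ι ℝ) : ∃ C, 0 < C ∧ ∀ x, quad Q x ≤ C * quad P x := by
  have hcont : ∀ M : Matrix ι ι ℝ, Continuous (quad M) := fun M => by unfold quad; fun_prop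
  have hne : ∀ u ∈ Metric.sphere (0 : ι → ℝ) 1, u ≠ 0 := fun u hu h => by
    simp [h] at hu
  obtain ⟨C, hC⟩ := (isCompact_sphere (0 : ι → ℝ) 1).exists_bound_of_continuousOn
    (f := fun u => quad Q u / quad P u)
    ((hcont Q).continuousOn.div (hcont P).continuousOn fun u hu => (hP u (hne u hu)).ne')
  refine ⟨max C 1, by positivity, fun x => ?_⟩
  rcases eq_or_ne x 0 with rfl | hx
  · simp [quad]
  have hn : 0 < ‖x‖ := norm_pos_iff.2 hx
  have hu : ‖x‖⁻¹ • x ∈ Metric.sphere (0 : ι → ℝ) 1 := by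
    simp [norm_smul, hn.ne']
  have h1 := (le_abs_self _).trans (hC _ hu)
  have h2 := hP _ (hne _ hu)
  rw [div_le_iff₀ h2, quad_smul_vec, quad_smul_vec, mul_left_comm] at h1
  exact (le_of_mul_le_mul_left h1 (by positivity)).trans
    (mul_le_mul_of_nonneg_right (le_max_left _ _) (hP x hx).le)

theorem transpose_eq_of_posDef {ι : Type*} {P : Matrix ι ι ℝ} (hP : P.PosDef) : Pᵀ = P := by
  simpa [Matrix.IsHermitian, Matrix.conjTranspose_eq_transpose_of_trivial] using hP.isHermitian

section Quad

variable {ι : Type*} [Fintype ι]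

theorem posDef_of_quad [DecidableEq ι] {P : Matrix ι ι ℝ} (hs : Pᵀ = P)
    (hP : ∀ x, x ≠ 0 → 0 < quad P x) : P.PosDef :=
  .of_dotProduct_mulVec_pos (by rw [Matrix.IsHermitian, Matrix.conjTranspose_eq_transpose_of_trivial,
    hs]) fun x hx => by simpa [quad] using hP x hx

theorem quad_pos_of_posDef {P : Matrix ι ι ℝ} (hP : P.PosDef) {x : ι → ℝ} (hx : x ≠ 0) :
    0 < quad P x := by
  simpa [quad] using hP.dotProduct_mulVec_pos hx

theorem quad_add_vec {P : Matrix ι ι ℝ} (hs : Pᵀ = P) (x y : ι → ℝ) :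
    quad P (x + y) = quad P x + 2 * (x ⬝ᵥ P *ᵥ y) + quad P y := by
  have : y ⬝ᵥ P *ᵥ x = x ⬝ᵥ P *ᵥ y := by
    rw [Matrix.dotProduct_mulVec, ← Matrix.mulVec_transpose, hs, dotProduct_comm]
  simp only [quad, Matrix.mulVec_add, add_dotProduct, dotProduct_add, this]
  ring

/-- The determinant is the product of the eigenvalues, each the value of the form at a unit
eigenvector. -/
theorem one_lt_det_of_quad [DecidableEq ι] [Nonempty ι] {T : Matrix ι ι ℝ} (hs : Tᵀ = T)
    (hT : ∀ x, x ≠ 0 → quad 1 x < quad T x) : 1 < T.det := by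
  have hH : T.IsHermitian := by
    rw [Matrix.IsHermitian, Matrix.conjTranspose_eq_transpose_of_trivial, hs]
  rw [hH.det_eq_prod_eigenvalues]
  have : ∀ i, 1 < hH.eigenvalues i := fun i => by
    have hn : (hH.eigenvectorBasis i).ofLp ≠ 0 := fun h => by
      have h2 := hH.eigenvectorBasis.orthonormal.1 i
      rw [show hH.eigenvectorBasis i = 0 from WithLp.ofLp_injective 2 h] at h2
      simp at h2
    have h1 : quad 1 (hH.eigenvectorBasis i).ofLp = 1 := by
      have := hH.eigenvectorBasis.orthonormal.1 i
      rw [quad_one, ← one_pow 2, ← this, EuclideanSpace.real_norm_sq_eq]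
      simp [dotProduct, sq]
    have h3 := hT _ hn
    rw [h1] at h3
    rw [hH.eigenvalues_eq]
    simpa [quad] using h3
  simpa using Finset.prod_lt_prod_of_nonempty (s := Finset.univ) (f := fun _ => (1 : ℝ))
    (fun _ _ => one_pos) (fun i _ => this i) Finset.univ_nonempty

-- Factor S = RᵀR; congruence by R⁻¹ reduces to the case S = 1.
open scoped MatrixOrder in
theorem det_lt_det_of_quad [DecidableEq ι] [Nonempty ι] {S P : Matrix ι ι ℝ} (hS : S.PosDef)
    (hs : Pᵀ = P) (h : ∀ x, x ≠ 0 → quad S x < quad P x) : S.det < P.det := by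
  obtain ⟨R, hR⟩ := CStarAlgebra.nonneg_iff_eq_star_mul_self.mp hS.posSemidef.nonneg
  have hR' : S = Rᵀ * R := by simpa [Matrix.star_eq_conjTranspose] using hR
  have hdet : S.det = R.det * R.det := by rw [hR', Matrix.det_mul, Matrix.det_transpose]
  have hne : R.det ≠ 0 := fun h0 => hS.det_pos.ne' (by rw [hdet, h0, zero_mul])
  have hu : IsUnit R.det := isUnit_iff_ne_zero.2 hne
  have h1 : 1 < (R⁻¹ᵀ * P * R⁻¹).det := by
    refine one_lt_det_of_quad ?_ fun x hx => ?_
    · simp [Matrix.transpose_mul, hs, Matrix.mul_assoc]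
    · have hx' : R⁻¹ *ᵥ x ≠ 0 := fun h0 => hx <| by
        rw [← Matrix.one_mulVec x, ← Matrix.mul_nonsing_inv R hu, ← Matrix.mulVec_mulVec, h0,
          Matrix.mulVec_zero]
      have := h _ hx'
      rw [quad_conj]
      refine lt_of_eq_of_lt ?_ this
      rw [hR', ← Matrix.mul_one Rᵀ, quad_conj, Matrix.mulVec_mulVec, Matrix.mul_nonsing_inv R hu,
        Matrix.one_mulVec]
  rw [Matrix.det_mul, Matrix.det_mul, Matrix.det_transpose, Matrix.det_nonsing_inv,
    Ring.inverse_eq_inv'] at h1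
  rw [hdet]
  have h2 : 0 < R.det * R.det := mul_self_pos.2 hne
  calc R.det * R.det = R.det * R.det * 1 := by ring
    _ < R.det * R.det * (R.det⁻¹ * P.det * R.det⁻¹) := by gcongr
    _ = P.det := by field_simp

end Quad

/-! ### Schur stability and the Lyapunov equation -/

section Lyapunov

attribute [local instance] Matrix.linftyOpNormedRing Matrix.linftyOpNormedAlgebra

variable {n : ℕ}

theorem mem_eigenvalues {A : Matrix (Fin n) (Fin n) ℝ} {z : ℂ} :
    z ∈ eigenvalues A ↔ z ∈ spectrum ℂ (A.map (algebraMap ℝ ℂ)) := by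
  rw [Matrix.mem_spectrum_iff_isRoot_charpoly, eigenvalues,
    Polynomial.mem_roots (Matrix.charpoly_monic _).ne_zero]

/-- Gelfand's formula for the complexified matrix, whose powers have the same norms; ρ lies between
the spectral radius and 1. -/
theorem exists_norm_pow_le (A : Matrix (Fin n) (Fin n) ℝ) (hA : ∀ z ∈ eigenvalues A, ‖z‖ < 1) :
    ∃ ρ : ℝ, 0 ≤ ρ ∧ ρ < 1 ∧ ∀ᶠ k in Filter.atTop, ‖A ^ k‖ ≤ ρ ^ k := by
  rcases isEmpty_or_nonempty (Fin n) with hn | hn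
  · refine ⟨0, le_rfl, one_pos, .of_forall fun k => ?_⟩
    rw [Subsingleton.elim (A ^ k) 0, norm_zero]
    positivity
  set M : Matrix (Fin n) (Fin n) ℂ := A.map (algebraMap ℝ ℂ)
  have hnorm : ∀ k, ‖A ^ k‖ = ‖M ^ k‖ := fun k => by
    have : M ^ k = (A ^ k).map (algebraMap ℝ ℂ) := (Matrix.map_pow A (algebraMap ℝ ℂ) k).symm
    rw [this, Matrix.linfty_opNorm_def, Matrix.linfty_opNorm_def]
    simp
  have hlt : spectralRadius ℂ M < (1 : NNReal) :=
    spectrum.spectralRadius_lt_of_forall_lt M fun z hz => by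
      simpa [← NNReal.coe_lt_coe] using hA z (mem_eigenvalues.2 hz)
  obtain ⟨ρ, h1, h2⟩ := ENNReal.lt_iff_exists_nnreal_btwn.1 hlt
  refine ⟨ρ, ρ.2, by exact_mod_cast h2, ?_⟩
  filter_upwards [(spectrum.pow_nnnorm_pow_one_div_tendsto_nhds_spectralRadius M).eventually_lt_const
    h1, Filter.eventually_gt_atTop 0] with k hk hk0
  rw [hnorm]
  have hk' : (k : ℝ) ≠ 0 := by positivity
  have := ENNReal.rpow_lt_rpow hk (show (0 : ℝ) < k by positivity)
  rw [← ENNReal.rpow_mul, one_div_mul_cancel hk', ENNReal.rpow_one, ENNReal.rpow_natCast] at this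
  have h3 : ‖M ^ k‖₊ < ρ ^ k := by exact_mod_cast this
  exact_mod_cast h3.le

theorem eigenvalues_transpose (A : Matrix (Fin n) (Fin n) ℝ) :
    eigenvalues Aᵀ = eigenvalues A := by
  rw [eigenvalues, eigenvalues, ← Matrix.charpoly_transpose, Matrix.transpose_map,
    Matrix.transpose_transpose]

theorem summable_lyapunov (A Q : Matrix (Fin n) (Fin n) ℝ) (hA : ∀ z ∈ eigenvalues A, ‖z‖ < 1) :
    Summable fun k => Aᵀ ^ k * Q * A ^ k := by
  obtain ⟨ρ, h0, h1, h⟩ := exists_norm_pow_le A hA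
  -- The norm in use is not invariant under transposition, so Aᵀ gets its own rate.
  obtain ⟨σ, g0, g1, g⟩ := exists_norm_pow_le Aᵀ (by rwa [eigenvalues_transpose])
  refine Summable.of_norm_bounded_eventually_nat (g := fun k => ‖Q‖ * (σ * ρ) ^ k)
    ((summable_geometric_of_lt_one (mul_nonneg g0 h0) (by nlinarith)).mul_left _) ?_
  filter_upwards [h, g] with k hk gk
  calc ‖Aᵀ ^ k * Q * A ^ k‖ ≤ ‖Aᵀ ^ k‖ * ‖Q‖ * ‖A ^ k‖ :=
        (norm_mul_le _ _).trans (mul_le_mul_of_nonneg_right (norm_mul_le _ _) (norm_nonneg _))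
    _ ≤ σ ^ k * ‖Q‖ * ρ ^ k := by gcongr
    _ = ‖Q‖ * (σ * ρ) ^ k := by rw [mul_pow]; ring

end Lyapunov

section Lyapunov

variable {n : ℕ}

theorem hasSum_quad {ι β : Type*} [Fintype ι] {f : β → Matrix ι ι ℝ} {P : Matrix ι ι ℝ}
    (h : HasSum f P) (x : ι → ℝ) : HasSum (fun k => quad (f k) x) (quad P x) := by
  let φ : Matrix ι ι ℝ →+ ℝ := ⟨⟨fun M => quad M x, by simp [quad]⟩, fun M N => quad_add M N x⟩
  refine h.map φ ?_
  change Continuous fun M : Matrix ι ι ℝ => x ⬝ᵥ M *ᵥ x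
  fun_prop

/-- P is the sum of Aᵀ^k Q A^k; removing the first term of the series gives the equation. -/
theorem exists_lyapunov (A Q : Matrix (Fin n) (Fin n) ℝ) (hA : ∀ z ∈ eigenvalues A, ‖z‖ < 1)
    (hs : Qᵀ = Q) (hQ : ∀ x, 0 ≤ quad Q x) :
    ∃ P : Matrix (Fin n) (Fin n) ℝ, Pᵀ = P ∧ (∀ x, 0 ≤ quad P x) ∧ P = Aᵀ * P * A + Q := by
  obtain ⟨P, hP⟩ : ∃ P, HasSum (fun k => Aᵀ ^ k * Q * A ^ k) P := summable_lyapunov A Q hA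
  refine ⟨P, ?_, fun x => ?_, ?_⟩
  · have := hP.matrix_transpose
    refine this.unique ?_
    simpa [Matrix.transpose_mul, Matrix.transpose_pow, hs, Matrix.mul_assoc] using hP
  · refine (hasSum_quad hP x).nonneg fun k => ?_
    rw [← Matrix.transpose_pow, quad_conj]
    exact hQ _
  · have h1 := (hasSum_nat_add_iff' 1).2 hP
    have h2 := (hP.mul_left Aᵀ).mul_right A
    have h3 : (fun k => Aᵀ ^ (k + 1) * Q * A ^ (k + 1)) =
        fun k => Aᵀ * (Aᵀ ^ k * Q * A ^ k) * A := by
      funext k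
      rw [pow_succ', pow_succ]
      simp only [Matrix.mul_assoc]
    rw [h3] at h1
    have h4 := h1.unique h2
    rw [← h4]
    simp

end Lyapunov

/-! ### Splitting the spectrum by modulus -/

section Split

open Polynomial

theorem norm_eq_of_isConjRoot {z w : ℂ} (h : IsConjRoot ℝ z w) : ‖z‖ = ‖w‖ := by
  have : IsAlgClosure ℝ ℂ := ⟨inferInstance, inferInstance⟩
  have : Normal ℝ ℂ := IsAlgClosure.normal ℝ ℂ
  obtain ⟨σ, hσ⟩ := isConjRoot_iff_exists_algEquiv.1 h
  rcases Complex.real_algHom_eq_id_or_conj (σ : ℂ →ₐ[ℝ] ℂ) with h1 | h1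
  · have : σ w = w := by simpa using congrArg (fun f : ℂ →ₐ[ℝ] ℂ => f w) h1
    rw [← hσ, this]
  · have : σ w = (starRingEnd ℂ) w := by simpa using congrArg (fun f : ℂ →ₐ[ℝ] ℂ => f w) h1
    rw [← hσ, this, Complex.norm_conj]

/-- A real polynomial splits according to the modulus of its complex roots. -/
theorem exists_factor_of_norm (S : Set ℝ) (p : ℝ[X]) (hp : p ≠ 0) :
    ∃ q r : ℝ[X], p = q * r ∧ (∀ z : ℂ, aeval z q = 0 → ‖z‖ ∈ S) ∧
      ∀ z : ℂ, aeval z r = 0 → ‖z‖ ∉ S := by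
  induction p using WfDvdMonoid.induction_on_irreducible with
  | zero => exact absurd rfl hp
  | unit u hu =>
    refine ⟨u, 1, by simp, fun z hz => ?_, fun z hz => by simp at hz⟩
    exact absurd hz (hu.map (aeval z)).ne_zero
  | mul a i ha hi ih =>
    obtain ⟨q, r, rfl, hq, hr⟩ := ih ha
    -- Roots of one irreducible real factor share a minimal polynomial, so they are equal or complex
    -- conjugate, and each factor goes wholly to one side.
    have hconj : ∀ z w : ℂ, aeval z i = 0 → aeval w i = 0 → ‖z‖ = ‖w‖ := fun z w hz hw =>
      norm_eq_of_isConjRoot <| by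
        rw [IsConjRoot, ← minpoly.eq_of_irreducible hi hz, ← minpoly.eq_of_irreducible hi hw]
    by_cases h : ∃ z : ℂ, ‖z‖ ∈ S ∧ aeval z i = 0
    · obtain ⟨z, hz, hzi⟩ := h
      refine ⟨i * q, r, by ring, fun w hw => ?_, hr⟩
      rw [map_mul, mul_eq_zero] at hw
      rcases hw with hw | hw
      · rwa [hconj w z hw hzi]
      · exact hq w hw
    · push Not at h
      refine ⟨q, i * r, by ring, hq, fun w hw => ?_⟩
      rw [map_mul, mul_eq_zero] at hw
      rcases hw with hw | hw
      · exact fun hS => h w hS hw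
      · exact hr w hw

/-- Spectral mapping: q(z) lies in the spectrum of q(A) = 0. -/
theorem aeval_eq_zero_of_mem_eigenvalues {n : ℕ} {A : Matrix (Fin n) (Fin n) ℝ} {q : ℝ[X]}
    (hq : aeval A q = 0) {z : ℂ} (hz : z ∈ eigenvalues A) : aeval z q = 0 := by
  rw [mem_eigenvalues] at hz
  have h := spectrum.subset_polynomial_aeval (A.map (algebraMap ℝ ℂ)) (q.map (algebraMap ℝ ℂ))
    ⟨z, hz, rfl⟩
  have h0 : aeval (A.map (algebraMap ℝ ℂ)) (q.map (algebraMap ℝ ℂ)) = 0 := by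
    have := congrArg (fun M : Matrix (Fin n) (Fin n) ℝ => (algebraMap ℝ ℂ).mapMatrix M) hq
    simp only [map_zero] at this
    rw [← this, aeval_map_algebraMap]
    exact aeval_algHom_apply (Algebra.ofId ℝ ℂ).mapMatrix A q
  have hz0 : eval z (q.map (algebraMap ℝ ℂ)) = 0 := by
    rw [h0] at h
    have : Nontrivial (Matrix (Fin n) (Fin n) ℂ) := by
      by_contra hn
      rw [not_nontrivial_iff_subsingleton] at hn
      exact (spectrum.of_subsingleton (R := ℂ) (A.map (algebraMap ℝ ℂ)) ▸ hz :)
    simpa [spectrum.zero_eq] using h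
  rwa [eval_map_algebraMap] at hz0

/-- A real matrix is block diagonal, up to a change of basis, with respect to a partition of its
eigenvalues by modulus. -/
theorem exists_spectral_split {n : ℕ} (A : Matrix (Fin n) (Fin n) ℝ) (S : Set ℝ) :
    ∃ (r s : ℕ) (C₁ : Matrix (Fin n) (Fin r) ℝ) (D₁ : Matrix (Fin r) (Fin n) ℝ)
      (D₂ : Matrix (Fin s) (Fin n) ℝ) (A₁ : Matrix (Fin r) (Fin r) ℝ)
      (A₂ : Matrix (Fin s) (Fin s) ℝ),
      A * C₁ = C₁ * A₁ ∧ D₁ * A = A₁ * D₁ ∧ D₂ * A = A₂ * D₂ ∧ D₁ * C₁ = 1 ∧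
      (∀ x, D₁ *ᵥ x = 0 → D₂ *ᵥ x = 0 → x = 0) ∧
      eigenvalues A = eigenvalues A₁ + eigenvalues A₂ ∧
      (∀ z ∈ eigenvalues A₁, ‖z‖ ∈ S) ∧ ∀ z ∈ eigenvalues A₂, ‖z‖ ∉ S := by
  obtain ⟨p, q, hpq, hp, hq⟩ := exists_factor_of_norm S A.charpoly A.charpoly_monic.ne_zero
  have hcop : IsCoprime p q := (isCoprime_iff_aeval_ne_zero_of_isAlgClosed (k := ℝ) ℂ p q).2 fun z => by
    by_contra! h
    exact hq z h.2 (hp z h.1)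
  set f : Module.End ℝ (Fin n → ℝ) := Matrix.toLin' A with hf
  set U := LinearMap.ker (aeval f p) with hU
  set W := LinearMap.ker (aeval f q) with hW
  -- Kernel decomposition for coprime factors; Cayley–Hamilton makes the kernels span.
  have hUW : IsCompl U W := by
    refine ⟨disjoint_ker_aeval_of_isCoprime f hcop, codisjoint_iff.2 ?_⟩
    rw [sup_ker_aeval_eq_ker_aeval_mul_of_coprime f hcop, ← hpq]
    have : aeval f A.charpoly = 0 := by
      have := LinearMap.aeval_self_charpoly f
      rwa [hf, Matrix.charpoly_toLin'] at this
    rw [this, LinearMap.ker_zero]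
  have hinv : ∀ g : ℝ[X], ∀ x ∈ LinearMap.ker (aeval f g), f x ∈ LinearMap.ker (aeval f g) := by
    intro g x hx
    rw [LinearMap.mem_ker] at hx ⊢
    have : aeval f g * f = f * aeval f g := by
      have h : Commute (aeval f g) (aeval f X) := (Commute.all g (X : ℝ[X])).map (aeval f)
      simpa using h.eq
    rw [← Module.End.mul_apply, this, Module.End.mul_apply, hx, map_zero]
  let fU : Module.End ℝ U := f.restrict (hinv p)
  let fW : Module.End ℝ W := f.restrict (hinv q)
  let bU := Module.finBasis ℝ U
  let bW := Module.finBasis ℝ W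
  let e := Submodule.prodEquivOfIsCompl U W hUW
  let πU : (Fin n → ℝ) →ₗ[ℝ] U := LinearMap.fst ℝ U W ∘ₗ e.symm
  let πW : (Fin n → ℝ) →ₗ[ℝ] W := LinearMap.snd ℝ U W ∘ₗ e.symm
  let std := Pi.basisFun ℝ (Fin n)
  have hconj : e.conj (fU.prodMap fW) = f := by
    refine LinearMap.ext fun x => ?_
    obtain ⟨⟨u, w⟩, rfl⟩ := e.surjective x
    simp [e, LinearEquiv.conj_apply, fU, fW]
  have hcomm : e.symm ∘ₗ f = (fU.prodMap fW) ∘ₗ e.symm := by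
    rw [← hconj]
    refine LinearMap.ext fun x => ?_
    simp [LinearEquiv.conj_apply]
  have hA : LinearMap.toMatrix std std f = A := by
    rw [hf]
    exact LinearMap.toMatrix'_toLin' A
  have hrestr : ∀ (g : ℝ[X]),
      aeval (f.restrict (hinv g)) g = 0 := fun g => by
    refine LinearMap.ext fun x => Subtype.ext ?_
    have h1 : ∀ h : ℝ[X], ((aeval (f.restrict (hinv g)) h) x : Fin n → ℝ) = aeval f h x := by
      intro h
      induction h using Polynomial.induction_on' generalizing x with
      | add a b ha hb => simp [ha, hb]
      | monomial k c =>
        simp only [aeval_monomial, Module.End.mul_apply, Module.algebraMap_end_apply,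
          Submodule.coe_smul]
        rw [Module.End.pow_restrict k (hinv g)]
        rfl
    rw [h1]
    exact x.2
  have htoM : ∀ {k : ℕ} (V : Submodule ℝ (Fin n → ℝ)) (b : Module.Basis (Fin k) ℝ V)
      (φ : Module.End ℝ V) (g : ℝ[X]), aeval φ g = 0 → aeval (LinearMap.toMatrix b b φ) g = 0 := by
    intro k V b φ g h
    have := aeval_algHom_apply (LinearMap.toMatrixAlgEquiv b).toAlgHom φ g
    rw [h, map_zero] at this
    exact this
  -- C₁ is the inclusion of U; D₁ and D₂ are the projections to U and W in coordinates.
  refine ⟨_, _, LinearMap.toMatrix bU std U.subtype, LinearMap.toMatrix std bU πU,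
    LinearMap.toMatrix std bW πW, LinearMap.toMatrix bU bU fU, LinearMap.toMatrix bW bW fW,
    ?_, ?_, ?_, ?_, ?_, ?_, ?_, ?_⟩
  · conv_lhs => rw [← hA]
    rw [← LinearMap.toMatrix_comp, ← LinearMap.toMatrix_comp]
    rfl
  · conv_lhs => rw [← hA]
    rw [← LinearMap.toMatrix_comp, ← LinearMap.toMatrix_comp]
    congr 1
    rw [LinearMap.comp_assoc, hcomm]
    rfl
  · conv_lhs => rw [← hA]
    rw [← LinearMap.toMatrix_comp, ← LinearMap.toMatrix_comp]
    congr 1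
    rw [LinearMap.comp_assoc, hcomm]
    rfl
  · rw [← LinearMap.toMatrix_comp, ← LinearMap.toMatrix_id bU]
    congr 1
    refine LinearMap.ext fun u => ?_
    simp [πU, e]
  · intro x h1 h2
    have g1 : πU x = 0 := by
      have := LinearMap.toMatrix_mulVec_repr std bU πU x
      have hx : (std.repr x : Fin n → ℝ) = x := by ext i; simp [std]
      rw [hx, h1] at this
      refine bU.repr.map_eq_zero_iff.1 (DFunLike.coe_injective this.symm)
    have g2 : πW x = 0 := by
      have := LinearMap.toMatrix_mulVec_repr std bW πW x
      have hx : (std.repr x : Fin n → ℝ) = x := by ext i; simp [std]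
      rw [hx, h2] at this
      refine bW.repr.map_eq_zero_iff.1 (DFunLike.coe_injective this.symm)
    exact e.symm.map_eq_zero_iff.1 (Prod.ext g1 g2)
  · have : A.charpoly = (LinearMap.toMatrix bU bU fU).charpoly *
        (LinearMap.toMatrix bW bW fW).charpoly := by
      rw [LinearMap.charpoly_toMatrix, LinearMap.charpoly_toMatrix, ← LinearMap.charpoly_prodMap,
        ← e.charpoly_conj, hconj, hf, Matrix.charpoly_toLin']
    simp only [eigenvalues, Matrix.charpoly_map]
    rw [this, Polynomial.map_mul, Polynomial.roots_mul]
    exact mul_ne_zero ((Matrix.charpoly_monic _).map _).ne_zero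
      ((Matrix.charpoly_monic _).map _).ne_zero
  · exact fun z hz => hp z (aeval_eq_zero_of_mem_eigenvalues (htoM U bU fU p (hrestr p)) hz)
  · exact fun z hz => hq z (aeval_eq_zero_of_mem_eigenvalues (htoM W bW fW q (hrestr q)) hz)

end Split

/-! ### Rank-one updates and Cauchy–Schwarz -/

section RankOne

variable {ι : Type*} [Fintype ι]

theorem quad_vecMulVec (v x : ι → ℝ) : quad (Matrix.vecMulVec v v) x = (x ⬝ᵥ v) ^ 2 := by
  rw [quad, Matrix.vecMulVec_mulVec, dotProduct_comm v x]
  simp [sq]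

theorem det_add_vecMulVec [DecidableEq ι] {M : Matrix ι ι ℝ} (hM : IsUnit M.det) (u v : ι → ℝ) :
    (M + Matrix.vecMulVec u v).det = M.det * (1 + v ⬝ᵥ M⁻¹ *ᵥ u) := by
  rw [Matrix.vecMulVec_eq Unit, Matrix.det_add_replicateCol_mul_replicateRow hM, Matrix.mul_assoc,
    Matrix.det_unique (n := Unit)]
  simp [Matrix.mul_apply, dotProduct, Matrix.mulVec]

theorem mulVec_fin_one {κ : Type*} (B : Matrix κ (Fin 1) ℝ) (u : Fin 1 → ℝ) :
    B *ᵥ u = u 0 • fun i => B i 0 := by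
  ext i
  simp [Matrix.mulVec, dotProduct, mul_comm]

theorem quad_add_smul {P : Matrix ι ι ℝ} (hs : Pᵀ = P) (x b : ι → ℝ) (t : ℝ) :
    quad P (x + t • b) = quad P x + 2 * t * (x ⬝ᵥ P *ᵥ b) + t ^ 2 * quad P b := by
  rw [quad_add_vec hs, quad_smul_vec, Matrix.mulVec_smul, dotProduct_smul, smul_eq_mul]
  ring

/-- Discriminant of the nonnegative quadratic t ↦ `quad P (x + t • b)`. -/
theorem sq_dotProduct_mulVec_le {P : Matrix ι ι ℝ} (hs : Pᵀ = P) (hP : ∀ x, 0 ≤ quad P x)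
    (x b : ι → ℝ) : (x ⬝ᵥ P *ᵥ b) ^ 2 ≤ quad P x * quad P b := by
  have := discrim_le_zero (a := quad P b) (b := 2 * (x ⬝ᵥ P *ᵥ b)) (c := quad P x) fun t => by
    have := hP (x + t • b)
    rw [quad_add_smul hs] at this
    linarith
  rw [discrim] at this
  linarith

end RankOne

/-! ### Necessity: the determinant bound -/

section Riccati

variable {n r : ℕ}

/-- If the quadratic cost `P` decreases in mean along the closed loop, then `α * det A₁ ^ 2 < 1` for
the action `A₁` of `A` on an invariant subspace: whatever the gain, the expected next cost dominates
on this subspace a form of determinant at least `α * det A₁ ^ 2` times that of `P`. -/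
theorem mul_det_sq_lt_one {α : ℝ} (h0 : 0 < α) (h1 : α ≤ 1) [Nonempty (Fin r)]
    {A : Matrix (Fin n) (Fin n) ℝ} {B : Matrix (Fin n) (Fin 1) ℝ} {F : Matrix (Fin 1) (Fin n) ℝ}
    {C : Matrix (Fin n) (Fin r) ℝ} {A₁ : Matrix (Fin r) (Fin r) ℝ} {P : Matrix (Fin n) (Fin n) ℝ}
    (hAC : A * C = C * A₁) (hC : ∀ y, C *ᵥ y = 0 → y = 0) (hdet : A₁.det ≠ 0)
    (hB : (fun i => B i 0) ≠ 0) (hs : Pᵀ = P) (hP : ∀ x, x ≠ 0 → 0 < quad P x)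
    (hL : ∀ x, x ≠ 0 → quad (meanOp α A (A + B * F) P) x < quad P x) :
    α * A₁.det ^ 2 < 1 := by
  set b : Fin n → ℝ := fun i => B i 0 with hb
  have hP' : ∀ x, 0 ≤ quad P x := fun x => by
    rcases eq_or_ne x 0 with rfl | hx
    · simp [quad]
    · exact (hP x hx).le
  set s := quad P b with hsdef
  have hspos : 0 < s := hP b hB
  set c := (1 - α) / s with hc
  have hc0 : 0 ≤ c := div_nonneg (by linarith) hspos.le
  have hcs : c * s = 1 - α := div_mul_cancel₀ _ hspos.ne'
  set v : Fin r → ℝ := Cᵀ *ᵥ (P *ᵥ b) with hv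
  have hyv : ∀ y, y ⬝ᵥ v = (C *ᵥ y) ⬝ᵥ P *ᵥ b := fun y => by
    rw [hv, Matrix.dotProduct_mulVec, Matrix.vecMul_transpose]
  set P₁ : Matrix (Fin r) (Fin r) ℝ := Cᵀ * P * C with hP₁
  have hP₁s : P₁ᵀ = P₁ := by simp [hP₁, Matrix.transpose_mul, hs, Matrix.mul_assoc]
  have hP₁pos : ∀ y, y ≠ 0 → 0 < quad P₁ y := fun y hy => by
    rw [hP₁, quad_conj]
    exact hP _ fun h => hy (hC y h)
  have hP₁d := posDef_of_quad hP₁s hP₁pos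
  have hA₁ : ∀ y, y ≠ 0 → A₁ *ᵥ y ≠ 0 := fun y hy h =>
    hdet (Matrix.exists_mulVec_eq_zero_iff.1 ⟨y, hy, h⟩)
  -- S is the mean next cost, as a form in A₁y, after minimizing over the scalar input. By
  -- Cauchy–Schwarz S ≥ α P₁, hence S is positive definite.
  set S := P₁ + Matrix.vecMulVec (-c • v) v with hS
  have hquadS : ∀ y, quad S y = quad P₁ y - c * (y ⬝ᵥ v) ^ 2 := fun y => by
    rw [hS, Matrix.smul_vecMulVec, quad_add, quad_smul, quad_vecMulVec]
    ring
  have hSs : Sᵀ = S := by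
    rw [hS, Matrix.transpose_add, hP₁s, Matrix.smul_vecMulVec, Matrix.transpose_smul,
      Matrix.transpose_vecMulVec]
  set T := A₁ᵀ * S * A₁ with hT
  have hTs : Tᵀ = T := by simp [hT, Matrix.transpose_mul, hSs, Matrix.mul_assoc]
  have hTpos : ∀ y, y ≠ 0 → 0 < quad T y := fun y hy => by
    rw [hT, quad_conj, hquadS]
    have h2 := sq_dotProduct_mulVec_le hs hP' (C *ᵥ (A₁ *ᵥ y)) b
    rw [← hyv, ← quad_conj P C, ← hP₁] at h2
    have h3 := hP₁pos _ (hA₁ y hy)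
    have h4 := mul_le_mul_of_nonneg_left h2 hc0
    have h5 : c * (quad P₁ (A₁ *ᵥ y) * quad P b) = (1 - α) * quad P₁ (A₁ *ᵥ y) := by
      rw [← hcs]; ring
    nlinarith
  have hTlt : ∀ y, y ≠ 0 → quad T y < quad P₁ y := fun y hy => by
    refine lt_of_le_of_lt ?_ ((hL (C *ᵥ y) fun h => hy (hC y h)).trans_eq (quad_conj P C y).symm)
    have hx : A *ᵥ (C *ᵥ y) = C *ᵥ (A₁ *ᵥ y) := by
      rw [Matrix.mulVec_mulVec, hAC, Matrix.mulVec_mulVec]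
    rw [hT, quad_conj, hquadS, quad_meanOp, Matrix.add_mulVec, ← Matrix.mulVec_mulVec,
      mulVec_fin_one B, hx, quad_add_smul hs, ← hyv, hP₁, quad_conj]
    set t := (F *ᵥ (C *ᵥ y)) 0
    set z := (A₁ *ᵥ y) ⬝ᵥ v
    -- Completing the square in the input t.
    have h6 : 0 ≤ c * (z + t * s) ^ 2 := mul_nonneg hc0 (sq_nonneg _)
    have h7 : c * (z + t * s) ^ 2 = c * z ^ 2 + (1 - α) * (2 * t * z + t ^ 2 * s) := by
      rw [← hcs]; ring
    rw [h7] at h6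
    linarith
  have hdetlt := det_lt_det_of_quad (posDef_of_quad hTs hTpos) hP₁s hTlt
  have hP₁det := hP₁d.det_pos
  have hu : IsUnit P₁.det := isUnit_iff_ne_zero.2 hP₁det.ne'
  rw [hT, Matrix.det_mul, Matrix.det_mul, Matrix.det_transpose, hS, det_add_vecMulVec hu,
    Matrix.mulVec_smul, dotProduct_smul, smul_eq_mul] at hdetlt
  set w := P₁⁻¹ *ᵥ v with hw
  have hPw : P₁ *ᵥ w = v := by
    rw [hw, Matrix.mulVec_mulVec, Matrix.mul_nonsing_inv _ hu, Matrix.one_mulVec]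
  have hq : v ⬝ᵥ w = quad P₁ w := by rw [quad, hPw, dotProduct_comm]
  -- Cauchy–Schwarz at C w reads (v·w)² ≤ (v·w) s, because v·w = `quad P₁ w`.
  have hqs : v ⬝ᵥ w ≤ s := by
    have h2 := sq_dotProduct_mulVec_le hs hP' (C *ᵥ w) b
    rw [← hyv, ← quad_conj P C, ← hP₁, dotProduct_comm, ← hq] at h2
    have h3 : 0 ≤ v ⬝ᵥ w := by rw [hq, hP₁, quad_conj]; exact hP' _
    rcases h3.eq_or_lt with h4 | h4
    · rw [← h4]; exact hspos.le
    · exact le_of_mul_le_mul_left (by rwa [sq] at h2) h4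
  have h8 : α ≤ 1 + -c * (v ⬝ᵥ w) := by
    have := mul_le_mul_of_nonneg_left hqs hc0
    linarith
  have h9 : 0 ≤ A₁.det ^ 2 * P₁.det := mul_nonneg (sq_nonneg _) hP₁det.le
  have h10 := mul_le_mul_of_nonneg_left h8 h9
  nlinarith

/-- P is the sum of the iterates on 1. Polarization upgrades convergence of the forms to convergence
of the matrix entries. -/
theorem exists_fixedPoint_of_summable {α : ℝ} (h0 : 0 ≤ α) (h1 : α ≤ 1)
    {A G : Matrix (Fin n) (Fin n) ℝ}
    (h : ∀ x, Summable fun k => quad ((meanOp α A G)^[k] 1) x) :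
    ∃ P : Matrix (Fin n) (Fin n) ℝ, Pᵀ = P ∧ (∀ x, 0 ≤ quad P x) ∧ P = meanOp α A G P + 1 := by
  set f : ℕ → Matrix (Fin n) (Fin n) ℝ := fun k => (meanOp α A G)^[k] 1 with hf
  have hsucc : ∀ k, f (k + 1) = meanOp α A G (f k) := fun k => Function.iterate_succ_apply' _ _ _
  have hsymm : ∀ k, (f k)ᵀ = f k := fun k => by
    induction k with
    | zero => exact Matrix.transpose_one
    | succ k ih =>
      rw [hsucc, meanOp]
      simp [Matrix.transpose_mul, ih, Matrix.mul_assoc]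
  have hentry : ∀ k i j, f k i j = (quad (f k) (Pi.single i 1 + Pi.single j 1) -
      quad (f k) (Pi.single i 1) - quad (f k) (Pi.single j 1)) / 2 := fun k i j => by
    rw [quad_add_vec (hsymm k)]
    simp only [Matrix.mulVec_single_one, single_one_dotProduct, Matrix.col_apply]
    ring
  have hsum : Summable f := by
    refine Pi.summable.2 fun i => Pi.summable.2 fun j => ?_
    simp_rw [hentry]
    exact (((h _).sub (h _)).sub (h _)).div_const 2
  obtain ⟨P, hP⟩ := hsum
  refine ⟨P, ?_, fun x => ?_, ?_⟩
  · refine hP.matrix_transpose.unique ?_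
    simpa [hsymm] using hP
  · exact (hasSum_quad hP x).nonneg fun k =>
      quad_iterate_meanOp_nonneg h0 h1 A G quad_one_nonneg k x
  · have h2 := (hasSum_nat_add_iff' 1).2 hP
    have h3 : HasSum (fun k => f (k + 1)) (meanOp α A G P) := by
      simp_rw [hsucc, meanOp]
      exact (((hP.mul_left Aᵀ).mul_right A).const_smul α).add
        (((hP.mul_left Gᵀ).mul_right G).const_smul (1 - α))
    rw [← h2.unique h3]
    simp [hf]

end Riccati

/-! ### Eigenvalues, determinants and controllability -/

section Eigenvalues

variable {n r s : ℕ}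

theorem mem_eigenvalues_iff_exists {A : Matrix (Fin n) (Fin n) ℝ} {z : ℂ} :
    z ∈ eigenvalues A ↔ ∃ v : Fin n → ℂ, v ≠ 0 ∧ A.map (algebraMap ℝ ℂ) *ᵥ v = z • v := by
  rw [mem_eigenvalues, spectrum.mem_iff, Matrix.isUnit_iff_isUnit_det, isUnit_iff_ne_zero, not_not,
    ← Matrix.exists_mulVec_eq_zero_iff]
  refine exists_congr fun v => and_congr_right fun _ => ?_
  rw [Matrix.sub_mulVec, sub_eq_zero, Algebra.algebraMap_eq_smul_one, Matrix.smul_mulVec,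
    Matrix.one_mulVec, eq_comm]

theorem inv_mem_eigenvalues {A : Matrix (Fin n) (Fin n) ℝ} (hA : IsUnit A.det) {z : ℂ}
    (hz : z ∈ eigenvalues A⁻¹) : z⁻¹ ∈ eigenvalues A := by
  obtain ⟨v, hv, h⟩ := mem_eigenvalues_iff_exists.1 hz
  refine mem_eigenvalues_iff_exists.2 ⟨v, hv, ?_⟩
  have hmul : A.map (algebraMap ℝ ℂ) * A⁻¹.map (algebraMap ℝ ℂ) = 1 := by
    rw [← Matrix.map_mul, Matrix.mul_nonsing_inv A hA]
    simp
  have h1 : v = z • (A.map (algebraMap ℝ ℂ) *ᵥ v) := by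
    rw [← Matrix.mulVec_smul, ← h, Matrix.mulVec_mulVec, hmul, Matrix.one_mulVec]
  have hz0 : z ≠ 0 := by
    rintro rfl
    exact hv (by rw [h1, zero_smul])
  conv_rhs => rw [h1]
  rw [smul_smul, inv_mul_cancel₀ hz0, one_smul]

theorem div_mem_eigenvalues {A : Matrix (Fin n) (Fin n) ℝ} {t : ℝ} (ht : t ≠ 0) {z : ℂ}
    (hz : z ∈ eigenvalues (t • A)) : z / t ∈ eigenvalues A := by
  obtain ⟨v, hv, h⟩ := mem_eigenvalues_iff_exists.1 hz
  refine mem_eigenvalues_iff_exists.2 ⟨v, hv, ?_⟩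
  have ht' : (t : ℂ) ≠ 0 := by exact_mod_cast ht
  have h2 : (t • A).map (algebraMap ℝ ℂ) = (t : ℂ) • A.map (algebraMap ℝ ℂ) := by
    ext i j
    simp
  rw [h2, Matrix.smul_mulVec] at h
  rw [div_eq_inv_mul, mul_smul, ← h, smul_smul, inv_mul_cancel₀ ht', one_smul]

theorem det_ne_zero_of_eigenvalues {A : Matrix (Fin n) (Fin n) ℝ}
    (hA : ∀ z ∈ eigenvalues A, z ≠ 0) : A.det ≠ 0 := by
  intro h
  have h' : (A.map (algebraMap ℝ ℂ)).det = 0 := by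
    have := (algebraMap ℝ ℂ).map_det A
    rw [h, map_zero] at this
    exact this.symm
  obtain ⟨v, hv, hv0⟩ := Matrix.exists_mulVec_eq_zero_iff.2 h'
  exact hA 0 (mem_eigenvalues_iff_exists.2 ⟨v, hv, by simpa using hv0⟩) rfl

theorem det_sq_eq (A : Matrix (Fin n) (Fin n) ℝ) :
    A.det ^ 2 = ((eigenvalues A).map fun z => ‖z‖ ^ 2).prod := by
  have h1 : ((A.det : ℝ) : ℂ) = (eigenvalues A).prod := by
    rw [eigenvalues, ← Matrix.det_eq_prod_roots_charpoly]
    exact (algebraMap ℝ ℂ).map_det A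
  have h2 : A.det ^ 2 = ‖(eigenvalues A).prod‖ ^ 2 := by
    rw [← h1, Complex.norm_real, Real.norm_eq_abs, sq_abs]
  rw [h2, Multiset.prod_map_pow]
  congr 1
  exact map_multiset_prod (normHom : ℂ →*₀ ℝ) _

/-- Eigenvalues on the unit circle contribute a factor 1, so they may join the unstable block. -/
theorem prod_filter_norm (m : Multiset ℂ) (h : ∀ z ∈ m, 1 ≤ ‖z‖) :
    ((m.filter fun z => 1 < ‖z‖).map fun z => ‖z‖ ^ 2).prod = (m.map fun z => ‖z‖ ^ 2).prod := by
  induction m using Multiset.induction with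
  | empty => simp
  | cons a m ih =>
    have ih' := ih fun z hz => h z (Multiset.mem_cons_of_mem hz)
    rcases (h a (Multiset.mem_cons_self a m)).eq_or_lt with h1 | h1
    · rw [Multiset.filter_cons_of_neg _ (by rw [← h1]; exact lt_irrefl _), ih', Multiset.map_cons,
        Multiset.prod_cons, ← h1]
      simp
    · rw [Multiset.filter_cons_of_pos (p := fun z : ℂ => 1 < ‖z‖) _ h1, Multiset.map_cons, Multiset.prod_cons, ih',
        Multiset.map_cons, Multiset.prod_cons]

theorem unstableProd_eq_det_sq {A : Matrix (Fin n) (Fin n) ℝ} {A₁ : Matrix (Fin r) (Fin r) ℝ}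
    {A₂ : Matrix (Fin s) (Fin s) ℝ} (h : eigenvalues A = eigenvalues A₁ + eigenvalues A₂)
    (h₁ : ∀ z ∈ eigenvalues A₁, 1 ≤ ‖z‖) (h₂ : ∀ z ∈ eigenvalues A₂, ‖z‖ < 1) :
    unstableProd A = A₁.det ^ 2 := by
  rw [unstableProd, h, Multiset.filter_add, (Multiset.filter_eq_nil (s := eigenvalues A₂)).2
    fun z hz => (h₂ z hz).le.not_gt, add_zero, prod_filter_norm _ h₁, det_sq_eq]

theorem one_lt_unstableProd {A : Matrix (Fin n) (Fin n) ℝ} (hA : IsUnstable A) :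
    1 < unstableProd A := by
  obtain ⟨z, hz, hz1⟩ := hA
  have hge : ∀ m : Multiset ℂ, 1 ≤ ((m.filter fun z => 1 < ‖z‖).map fun z => ‖z‖ ^ 2).prod :=
    fun m => Multiset.one_le_prod fun x hx => by
      obtain ⟨w, hw, rfl⟩ := Multiset.mem_map.1 hx
      exact one_le_pow₀ (Multiset.mem_filter.1 hw).2.le
  obtain ⟨m, hm⟩ := Multiset.exists_cons_of_mem hz
  rw [unstableProd, hm, Multiset.filter_cons_of_pos (p := fun z : ℂ => 1 < ‖z‖) _ hz1, Multiset.map_cons, Multiset.prod_cons]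
  have := hge m
  nlinarith [one_lt_pow₀ hz1 two_ne_zero]

/-- By full rank y lies in the range of the controllability matrix, to which it is orthogonal. -/
theorem eq_zero_of_isControllable {m : ℕ} {A : Matrix (Fin n) (Fin n) ℝ}
    {B : Matrix (Fin n) (Fin m) ℝ} (hAB : IsControllable A B) (y : Fin n → ℝ)
    (hy : ∀ k < n, y ᵥ* (A ^ k * B) = 0) : y = 0 := by
  have hsurj : Function.Surjective (controllabilityMatrix A B).mulVecLin := by
    rw [← LinearMap.range_eq_top]
    refine Submodule.eq_top_of_finrank_eq ?_
    rw [Module.finrank_fin_fun]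
    exact hAB
  obtain ⟨x, hx⟩ := hsurj y
  have h0 : y ᵥ* controllabilityMatrix A B = 0 := by
    funext j
    exact congrFun (hy j.1 j.1.2) j.2
  have : y ⬝ᵥ y = 0 := by
    rw [Matrix.mulVecLin_apply] at hx
    nth_rewrite 2 [← hx]
    rw [Matrix.dotProduct_mulVec, h0, zero_dotProduct]
  exact dotProduct_self_eq_zero.1 this

end Eigenvalues

/-! ### Sufficiency: construction of the gain -/

section Sufficiency

variable {n r s : ℕ}

/-- The inverse of the backward controllability Gramian of an antistable pair. -/
theorem exists_inverse_gramian {A : Matrix (Fin r) (Fin r) ℝ} {b : Fin r → ℝ} {N : ℕ}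
    (hA : ∀ z ∈ eigenvalues A, 1 < ‖z‖)
    (hb : ∀ y, (∀ k < N, y ⬝ᵥ A ^ k *ᵥ b = 0) → y = 0) :
    ∃ P : Matrix (Fin r) (Fin r) ℝ, Pᵀ = P ∧ (∀ x, x ≠ 0 → 0 < quad P x) ∧
      1 + quad P b = A.det ^ 2 ∧
      ∀ x, quad P x = quad P (A *ᵥ x) - ((A *ᵥ x) ⬝ᵥ P *ᵥ b) ^ 2 / (1 + quad P b) := by
  have hdet : A.det ≠ 0 := det_ne_zero_of_eigenvalues fun z hz h => by
    have := hA z hz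
    rw [h, norm_zero] at this
    linarith
  have hu : IsUnit A.det := isUnit_iff_ne_zero.2 hdet
  set c : Fin r → ℝ := A⁻¹ *ᵥ b with hc
  have hinv : ∀ z ∈ eigenvalues A⁻¹ᵀ, ‖z‖ < 1 := fun z hz => by
    rw [eigenvalues_transpose] at hz
    have := hA _ (inv_mem_eigenvalues hu hz)
    rw [norm_inv] at this
    exact ((one_lt_inv_iff₀).1 this).2
  -- W = A⁻¹WA⁻ᵀ + ccᵀ is the backward Gramian; P will be its inverse.
  obtain ⟨W, hWs, hW0, hW⟩ := exists_lyapunov A⁻¹ᵀ (Matrix.vecMulVec c c) hinv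
    (Matrix.transpose_vecMulVec c c) fun x => by rw [quad_vecMulVec]; positivity
  rw [Matrix.transpose_transpose] at hW
  have hstep : ∀ x, quad W x = quad W (A⁻¹ᵀ *ᵥ x) + (x ⬝ᵥ c) ^ 2 := fun x => by
    conv_lhs => rw [hW]
    rw [quad_add, quad_vecMulVec, ← quad_conj, Matrix.transpose_transpose]
  have hker : ∀ k x, quad W x = 0 → quad W ((A⁻¹ᵀ ^ k) *ᵥ x) = 0 := fun k x hx => by
    induction k with
    | zero => simpa using hx
    | succ k ih =>
      rw [hstep] at ih
      have := hW0 (A⁻¹ᵀ *ᵥ (A⁻¹ᵀ ^ k *ᵥ x))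
      rw [pow_succ', ← Matrix.mulVec_mulVec]
      nlinarith [sq_nonneg ((A⁻¹ᵀ ^ k *ᵥ x) ⬝ᵥ c)]
  have hker' : ∀ k x, quad W x = 0 → x ⬝ᵥ (A⁻¹ ^ (k + 1)) *ᵥ b = 0 := fun k x hx => by
    have h := hker k x hx
    rw [hstep] at h
    have h2 := hW0 (A⁻¹ᵀ *ᵥ (A⁻¹ᵀ ^ k *ᵥ x))
    have h3 : (A⁻¹ᵀ ^ k *ᵥ x) ⬝ᵥ c = 0 := by
      nlinarith [sq_nonneg ((A⁻¹ᵀ ^ k *ᵥ x) ⬝ᵥ c)]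
    rw [← h3, hc, pow_succ, ← Matrix.mulVec_mulVec, Matrix.dotProduct_mulVec x,
      ← Matrix.transpose_pow, Matrix.mulVec_transpose]
  have hWpos : ∀ x, x ≠ 0 → 0 < quad W x := fun x hx => by
    refine (hW0 x).lt_of_ne' fun h => hx ?_
    -- The kernel of W annihilates negative powers of A applied to b, whereas `hb` concerns powers 0
    -- to N - 1; the factor A⁻ᴺ shifts one range into the other.
    have h1 : (A⁻¹ ^ N)ᵀ *ᵥ x = 0 := hb _ fun k hk => by
      obtain ⟨j, rfl⟩ := Nat.exists_eq_add_of_lt hk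
      rw [Matrix.mulVec_transpose, ← Matrix.dotProduct_mulVec, Matrix.mulVec_mulVec]
      have : A⁻¹ ^ (k + j + 1) * A ^ k = A⁻¹ ^ (j + 1) := by
        have h4 : A⁻¹ ^ k * A ^ k = 1 := by
          rw [← (Commute.mul_pow · k) ((Matrix.nonsing_inv_mul A hu).trans
            (Matrix.mul_nonsing_inv A hu).symm), Matrix.nonsing_inv_mul A hu, one_pow]
        rw [show k + j + 1 = (j + 1) + k by ring, pow_add, mul_assoc, h4, mul_one]
      rw [this]
      exact hker' j x h
    by_contra
    have h5 : ((A⁻¹ ^ N)ᵀ).det = 0 := Matrix.exists_mulVec_eq_zero_iff.1 ⟨x, hx, h1⟩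
    rw [Matrix.det_transpose, Matrix.det_pow, Matrix.det_nonsing_inv, Ring.inverse_eq_inv'] at h5
    exact pow_ne_zero N (inv_ne_zero hdet) h5
  have hWd := posDef_of_quad hWs hWpos
  have hWu : IsUnit W.det := isUnit_iff_ne_zero.2 hWd.det_pos.ne'
  have hAW : A * W * Aᵀ = W + Matrix.vecMulVec b b := by
    have h1 : A * (A⁻¹ * W * A⁻¹ᵀ) * Aᵀ = W := by
      rw [← Matrix.mul_assoc, ← Matrix.mul_assoc, Matrix.mul_nonsing_inv A hu, Matrix.one_mul,
        Matrix.mul_assoc, ← Matrix.transpose_mul, Matrix.mul_nonsing_inv A hu,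
        Matrix.transpose_one, Matrix.mul_one]
    have h2 : A * Matrix.vecMulVec c c * Aᵀ = Matrix.vecMulVec b b := by
      rw [Matrix.mul_vecMulVec, Matrix.vecMulVec_mul, Matrix.vecMul_transpose, hc,
        Matrix.mulVec_mulVec, Matrix.mul_nonsing_inv A hu, Matrix.one_mulVec]
    conv_lhs => rw [hW]
    rw [Matrix.mul_add, Matrix.add_mul, h1, h2]
  have hPd := hWd.inv
  set P := W⁻¹ with hP
  have hPs : Pᵀ = P := transpose_eq_of_posDef hPd
  have hPpos : ∀ x, x ≠ 0 → 0 < quad P x := fun x hx => quad_pos_of_posDef hPd hx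
  have hq0 : 0 ≤ quad P b := by
    rcases eq_or_ne b 0 with h | h
    · simp [h, quad]
    · exact (hPpos b h).le
  refine ⟨P, hPs, hPpos, ?_, fun x => ?_⟩
  · have h1 := congrArg Matrix.det hAW
    rw [det_add_vecMulVec hWu, Matrix.det_mul, Matrix.det_mul, Matrix.det_transpose] at h1
    have h2 : W.det * (1 + quad P b) = W.det * A.det ^ 2 := by
      rw [quad, ← h1]
      ring
    exact mul_left_cancel₀ hWd.det_pos.ne' h2
  · set q := quad P b with hq
    set β := P *ᵥ b with hβ
    -- Sherman–Morrison inverse of W + bbᵀ = AWAᵀ.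
    set X := P - (1 + q)⁻¹ • Matrix.vecMulVec β β with hX
    have hq1 : (1 + q) ≠ 0 := by positivity
    have h1 : A * W * Aᵀ * X = 1 := by
      have e1 : W * P = 1 := Matrix.mul_nonsing_inv W hWu
      have e2 : W *ᵥ β = b := by rw [hβ, Matrix.mulVec_mulVec, e1, Matrix.one_mulVec]
      have e3 : b ᵥ* P = β := by rw [hβ, ← Matrix.mulVec_transpose, hPs]
      rw [hAW, hX, Matrix.mul_sub, Matrix.add_mul, Matrix.mul_smul, Matrix.add_mul, e1,
        Matrix.mul_vecMulVec, e2, Matrix.vecMulVec_mul, e3, Matrix.vecMulVec_mul_vecMulVec,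
        show b ⬝ᵥ β = q from rfl, Matrix.vecMulVec_smul]
      have : Matrix.vecMulVec b β + q • Matrix.vecMulVec b β = (1 + q) • Matrix.vecMulVec b β := by
        rw [add_smul, one_smul]
      rw [this, smul_smul, inv_mul_cancel₀ hq1, one_smul, add_sub_cancel_right]
    have h2 : W * (Aᵀ * X * A) = 1 := by
      rw [Matrix.mul_assoc, Matrix.mul_assoc, mul_eq_one_comm] at h1
      simpa only [Matrix.mul_assoc] using h1
    have h3 : P = Aᵀ * X * A := Matrix.inv_eq_right_inv h2
    conv_lhs => rw [h3]
    rw [quad_conj, hX, quad_sub, quad_smul, quad_vecMulVec, div_eq_inv_mul]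

/-- Mean-square stabilization, in the non-strict sense, of an antistable single-input pair. -/
theorem exists_gain_of_antistable {α : ℝ} {A : Matrix (Fin r) (Fin r) ℝ}
    {B : Matrix (Fin r) (Fin 1) ℝ} {N : ℕ} (hA : ∀ z ∈ eigenvalues A, 1 < ‖z‖)
    (hb : ∀ y, (∀ k < N, y ⬝ᵥ A ^ k *ᵥ (fun i => B i 0) = 0) → y = 0) (hdet : 1 < A.det ^ 2)
    (hα : α * A.det ^ 2 ≤ 1) :
    ∃ (P : Matrix (Fin r) (Fin r) ℝ) (F : Matrix (Fin 1) (Fin r) ℝ), Pᵀ = P ∧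
      (∀ x, x ≠ 0 → 0 < quad P x) ∧ ∀ x, quad (meanOp α A (A + B * F) P) x ≤ quad P x := by
  obtain ⟨P, hs, hP, hq, hric⟩ := exists_inverse_gramian hA hb
  set b : Fin r → ℝ := fun i => B i 0
  set q := quad P b
  have hq0 : 0 < q := by linarith
  -- This gain minimizes the cost P of the next state when the packet arrives.
  refine ⟨P, Matrix.of fun _ => -q⁻¹ • (Aᵀ *ᵥ (P *ᵥ b)), hs, hP, fun x => ?_⟩
  have ht : ((Matrix.of fun _ : Fin 1 => -q⁻¹ • (Aᵀ *ᵥ (P *ᵥ b))) *ᵥ x) 0 =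
      -q⁻¹ * ((A *ᵥ x) ⬝ᵥ P *ᵥ b) := by
    change (-q⁻¹ • (Aᵀ *ᵥ (P *ᵥ b))) ⬝ᵥ x = _
    rw [smul_dotProduct, smul_eq_mul, dotProduct_comm, Matrix.dotProduct_mulVec,
      Matrix.vecMul_transpose]
  rw [quad_meanOp, Matrix.add_mulVec, ← Matrix.mulVec_mulVec, mulVec_fin_one B, ht,
    quad_add_smul hs, hric x]
  set z := (A *ᵥ x) ⬝ᵥ P *ᵥ b
  set p := quad P (A *ᵥ x)
  have h2 : α * p + (1 - α) * (p + 2 * (-q⁻¹ * z) * z + (-q⁻¹ * z) ^ 2 * q) =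
      p - (1 - α) / q * z ^ 2 := by
    field_simp
    ring
  -- Equivalent to α (1 + q) ≤ 1, the hypothesis on α because 1 + q = (det A)².
  have h3 : (1 + q)⁻¹ ≤ (1 - α) / q := by
    rw [← hq] at hα
    rw [inv_eq_one_div, div_le_div_iff₀ (by positivity) hq0]
    linarith
  have h4 := mul_le_mul_of_nonneg_right h3 (sq_nonneg z)
  change α * p + (1 - α) * (p + 2 * (-q⁻¹ * z) * z + (-q⁻¹ * z) ^ 2 * q) ≤ _
  rw [h2, div_eq_inv_mul (z ^ 2)]
  linarith

/-- The strict bound on α survives replacing A by tA with t > 1 close to 1, which is antistable.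
Non-increase for tA is contraction by t⁻² for A. -/
theorem exists_gain_of_one_le {α : ℝ} {A : Matrix (Fin r) (Fin r) ℝ}
    {B : Matrix (Fin r) (Fin 1) ℝ} {N : ℕ} (hA : ∀ z ∈ eigenvalues A, 1 ≤ ‖z‖)
    (hb : ∀ y, (∀ k < N, y ⬝ᵥ A ^ k *ᵥ (fun i => B i 0) = 0) → y = 0) (hdet : 1 < A.det ^ 2)
    (hα : α * A.det ^ 2 < 1) :
    ∃ (ρ : ℝ) (P : Matrix (Fin r) (Fin r) ℝ) (F : Matrix (Fin 1) (Fin r) ℝ), 0 < ρ ∧ ρ < 1 ∧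
      Pᵀ = P ∧ (∀ x, x ≠ 0 → 0 < quad P x) ∧
      ∀ x, quad (meanOp α A (A + B * F) P) x ≤ ρ * quad P x := by
  obtain ⟨t, ht1, ht2⟩ : ∃ t : ℝ, 1 < t ∧ α * (t • A).det ^ 2 < 1 := by
    have hcont : ContinuousAt (fun t : ℝ => α * (t • A).det ^ 2) 1 := by
      simp only [Matrix.det_smul]
      fun_prop
    have hev : ∀ᶠ t : ℝ in nhds 1, α * (t • A).det ^ 2 < 1 :=
      Filter.Tendsto.eventually_lt_const (by simpa using hα) hcont
    obtain ⟨t, h, ht⟩ := ((hev.filter_mono nhdsWithin_le_nhds).and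
      (self_mem_nhdsWithin (s := Set.Ioi (1 : ℝ)))).exists
    exact ⟨t, ht, h⟩
  have ht0 : 0 < t := by linarith
  have hAt : ∀ z ∈ eigenvalues (t • A), 1 < ‖z‖ := fun z hz => by
    have := hA _ (div_mem_eigenvalues ht0.ne' hz)
    rw [norm_div, Complex.norm_real, Real.norm_of_nonneg ht0.le, le_div_iff₀ ht0] at this
    linarith
  have hbt : ∀ y, (∀ k < N, y ⬝ᵥ (t • A) ^ k *ᵥ (fun i => B i 0) = 0) → y = 0 :=
    fun y hy => hb y fun k hk => by
      have := hy k hk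
      rw [smul_pow, Matrix.smul_mulVec, dotProduct_smul, smul_eq_mul] at this
      exact (mul_eq_zero.1 this).resolve_left (pow_ne_zero k ht0.ne')
  have hdett : 1 < (t • A).det ^ 2 := by
    rw [Matrix.det_smul, mul_pow]
    have : 1 ≤ (t ^ Fintype.card (Fin r)) ^ 2 := one_le_pow₀ (one_le_pow₀ ht1.le)
    nlinarith
  obtain ⟨P, F, hs, hP, h⟩ := exists_gain_of_antistable hAt hbt hdett ht2.le
  refine ⟨(t ^ 2)⁻¹, P, t⁻¹ • F, by positivity, inv_lt_one_of_one_lt₀ (one_lt_pow₀ ht1 two_ne_zero),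
    hs, hP, fun x => ?_⟩
  have h2 : t • A + B * F = t • (A + B * (t⁻¹ • F)) := by
    rw [smul_add, Matrix.mul_smul, smul_smul, mul_inv_cancel₀ ht0.ne', one_smul]
  have h3 := h x
  rw [h2, quad_meanOp, Matrix.smul_mulVec, Matrix.smul_mulVec, quad_smul_vec, quad_smul_vec] at h3
  rw [quad_meanOp, ← div_eq_inv_mul, le_div_iff₀ (by positivity)]
  linarith

/-- With P = AᵀPA + 1 and P ≤ C · 1, each step loses at least the fraction C⁻¹ of P. -/
theorem exists_contraction_of_stable {A : Matrix (Fin s) (Fin s) ℝ}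
    (hA : ∀ z ∈ eigenvalues A, ‖z‖ < 1) :
    ∃ (ρ : ℝ) (P : Matrix (Fin s) (Fin s) ℝ), ρ < 1 ∧ Pᵀ = P ∧ (∀ x, x ≠ 0 → 0 < quad P x) ∧
      ∀ x, quad P (A *ᵥ x) ≤ ρ * quad P x := by
  obtain ⟨P, hs, hP0, hP⟩ := exists_lyapunov A 1 hA Matrix.transpose_one quad_one_nonneg
  have hone : ∀ x : Fin s → ℝ, x ≠ 0 → 0 < quad 1 x := fun x hx =>
    quad_pos_of_posDef Matrix.PosDef.one hx
  have hstep : ∀ x, quad P x = quad P (A *ᵥ x) + quad 1 x := fun x => by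
    conv_lhs => rw [hP]
    rw [quad_add, quad_conj]
  obtain ⟨C, hC, hle⟩ := exists_quad_le hone P
  refine ⟨1 - C⁻¹, P, by linarith [inv_pos.2 hC], hs, fun x hx => ?_, fun x => ?_⟩
  · rw [hstep]
    linarith [hP0 (A *ᵥ x), hone x hx]
  · have h2 : C⁻¹ * quad P x ≤ quad 1 x := by
      rw [inv_mul_le_iff₀ hC]
      exact hle x
    linarith [hstep x]

/-- Young's inequality, from nonnegativity of P at x - δ⁻¹y. -/
theorem quad_add_le {P : Matrix (Fin s) (Fin s) ℝ} (hs : Pᵀ = P) (hP : ∀ x, 0 ≤ quad P x)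
    {δ : ℝ} (hδ : 0 < δ) (x y : Fin s → ℝ) :
    quad P (x + y) ≤ (1 + δ) * quad P x + (1 + δ⁻¹) * quad P y := by
  have h := hP (x + (-δ⁻¹) • y)
  rw [quad_add_smul hs] at h
  rw [quad_add_vec hs]
  have h2 := mul_nonneg hδ.le h
  have h3 : δ * (quad P x + 2 * -δ⁻¹ * (x ⬝ᵥ P *ᵥ y) + (-δ⁻¹) ^ 2 * quad P y) =
      δ * quad P x - 2 * (x ⬝ᵥ P *ᵥ y) + δ⁻¹ * quad P y := by
    field_simp
    ring
  linarith

theorem summable_of_contraction {α ρ : ℝ} (h0 : 0 ≤ α) (h1 : α ≤ 1) (hρ0 : 0 ≤ ρ) (hρ : ρ < 1)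
    {A G P : Matrix (Fin n) (Fin n) ℝ} (hP : ∀ x, x ≠ 0 → 0 < quad P x)
    (h : ∀ x, quad (meanOp α A G P) x ≤ ρ * quad P x) (x : Fin n → ℝ) :
    Summable fun k => quad ((meanOp α A G)^[k] 1) x := by
  obtain ⟨C, hC, hle⟩ := exists_quad_le hP 1
  have hbound : ∀ k x, quad ((meanOp α A G)^[k] 1) x ≤ C * ρ ^ k * quad P x := by
    intro k
    induction k with
    | zero => simpa using hle
    | succ k ih =>
      intro x
      rw [Function.iterate_succ_apply', quad_meanOp]
      have h2 := mul_le_mul_of_nonneg_left (ih (A *ᵥ x)) h0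
      have h3 := mul_le_mul_of_nonneg_left (ih (G *ᵥ x)) (sub_nonneg.2 h1)
      have h4 := mul_le_mul_of_nonneg_left (h x) (show 0 ≤ C * ρ ^ k by positivity)
      rw [quad_meanOp] at h4
      calc _ ≤ _ := add_le_add h2 h3
        _ = C * ρ ^ k * (α * quad P (A *ᵥ x) + (1 - α) * quad P (G *ᵥ x)) := by ring
        _ ≤ _ := h4
        _ = _ := by ring
  refine Summable.of_nonneg_of_le (fun k => quad_iterate_meanOp_nonneg h0 h1 A G quad_one_nonneg k x)
    (fun k => hbound k x) ?_
  exact ((summable_geometric_of_lt_one hρ0 hρ).mul_left C).mul_right _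

/-- Lyapunov function for the cascade of a contracting subsystem into a stable one. -/
theorem exists_contraction_cascade {α ρ₁ ρ₂ : ℝ} (h0 : 0 ≤ α) (h1 : α ≤ 1) (hρ₁ : 0 < ρ₁)
    (hρ₁' : ρ₁ < 1) (hρ₂ : ρ₂ < 1) {A G : Matrix (Fin n) (Fin n) ℝ} {A₁ G₁ : Matrix (Fin r) (Fin r) ℝ}
    {A₂ : Matrix (Fin s) (Fin s) ℝ} {H : Matrix (Fin s) (Fin r) ℝ} {D₁ : Matrix (Fin r) (Fin n) ℝ}
    {D₂ : Matrix (Fin s) (Fin n) ℝ} {P₁ : Matrix (Fin r) (Fin r) ℝ} {P₂ : Matrix (Fin s) (Fin s) ℝ}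
    (hA₁ : D₁ * A = A₁ * D₁) (hA₂ : D₂ * A = A₂ * D₂) (hG₁ : D₁ * G = G₁ * D₁)
    (hG₂ : D₂ * G = A₂ * D₂ + H * D₁) (hD : ∀ x, D₁ *ᵥ x = 0 → D₂ *ᵥ x = 0 → x = 0)
    (hP₁ : ∀ x, x ≠ 0 → 0 < quad P₁ x) (hs₂ : P₂ᵀ = P₂) (hP₂ : ∀ x, x ≠ 0 → 0 < quad P₂ x)
    (hL₁ : ∀ x, quad (meanOp α A₁ G₁ P₁) x ≤ ρ₁ * quad P₁ x)
    (hL₂ : ∀ x, quad P₂ (A₂ *ᵥ x) ≤ ρ₂ * quad P₂ x) :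
    ∃ (ρ : ℝ) (P : Matrix (Fin n) (Fin n) ℝ), 0 ≤ ρ ∧ ρ < 1 ∧ (∀ x, x ≠ 0 → 0 < quad P x) ∧
      ∀ x, quad (meanOp α A G P) x ≤ ρ * quad P x := by
  have hnn : ∀ {k : ℕ} {Q : Matrix (Fin k) (Fin k) ℝ}, (∀ x, x ≠ 0 → 0 < quad Q x) →
      ∀ x, 0 ≤ quad Q x := fun hQ x => by
    rcases eq_or_ne x 0 with rfl | hx
    · simp [quad]
    · exact (hQ x hx).le
  obtain ⟨c, hc, hle⟩ := exists_quad_le hP₁ (Hᵀ * P₂ * H)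
  set σ := max ρ₁ ρ₂ with hσ
  have hσ0 : 0 < σ := hρ₁.trans_le (le_max_left _ _)
  have hσ1 : σ < 1 := max_lt hρ₁' hρ₂
  -- Half the contraction margin pays for the coupling: (1 + δ)σ ≤ σ + δ < 1. K weights the first
  -- block so that its share Kδ equals the coupling cost (1 + δ⁻¹)c.
  set δ := (1 - σ) / 2 with hδ
  have hδ0 : 0 < δ := by rw [hδ]; linarith
  set K := (1 + δ⁻¹) * c / δ with hK
  have hK0 : 0 < K := by positivity
  have hKδ : K * δ = (1 + δ⁻¹) * c := div_mul_cancel₀ _ hδ0.ne'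
  have hquad : ∀ x, quad (K • (D₁ᵀ * P₁ * D₁) + D₂ᵀ * P₂ * D₂) x =
      K * quad P₁ (D₁ *ᵥ x) + quad P₂ (D₂ *ᵥ x) := fun x => by
    rw [quad_add, quad_smul, quad_conj, quad_conj]
  refine ⟨σ + δ, K • (D₁ᵀ * P₁ * D₁) + D₂ᵀ * P₂ * D₂, by linarith, by rw [hδ]; linarith,
    fun x hx => ?_, fun x => ?_⟩
  · rw [hquad]
    by_cases h : D₁ *ᵥ x = 0
    · exact add_pos_of_nonneg_of_pos (mul_nonneg hK0.le (hnn hP₁ _)) (hP₂ _ fun h2 => hx (hD x h h2))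
    · exact add_pos_of_pos_of_nonneg (mul_pos hK0 (hP₁ _ h)) (hnn hP₂ _)
  · have e1 : D₁ *ᵥ (A *ᵥ x) = A₁ *ᵥ (D₁ *ᵥ x) := by simp only [Matrix.mulVec_mulVec, hA₁]
    have e2 : D₂ *ᵥ (A *ᵥ x) = A₂ *ᵥ (D₂ *ᵥ x) := by simp only [Matrix.mulVec_mulVec, hA₂]
    have e3 : D₁ *ᵥ (G *ᵥ x) = G₁ *ᵥ (D₁ *ᵥ x) := by simp only [Matrix.mulVec_mulVec, hG₁]
    have e4 : D₂ *ᵥ (G *ᵥ x) = A₂ *ᵥ (D₂ *ᵥ x) + H *ᵥ (D₁ *ᵥ x) := by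
      simp only [Matrix.mulVec_mulVec, hG₂, Matrix.add_mulVec]
    rw [quad_meanOp, hquad, hquad, hquad, e1, e2, e3, e4]
    set x₁ := D₁ *ᵥ x
    set x₂ := D₂ *ᵥ x
    have f1 := hL₁ x₁
    rw [quad_meanOp] at f1
    have f2 := quad_add_le hs₂ (hnn hP₂) hδ0 (A₂ *ᵥ x₂) (H *ᵥ x₁)
    have f3 := hle x₁
    rw [quad_conj] at f3
    have a0 := hnn hP₁ x₁
    have b0 := hnn hP₂ x₂
    have g0 := hnn hP₂ (A₂ *ᵥ x₂)
    have f4 : quad P₂ (A₂ *ᵥ x₂) ≤ σ * quad P₂ x₂ :=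
      (hL₂ x₂).trans (mul_le_mul_of_nonneg_right (le_max_right _ _) b0)
    have f5 : ρ₁ * quad P₁ x₁ ≤ σ * quad P₁ x₁ :=
      mul_le_mul_of_nonneg_right (le_max_left _ _) a0
    have w0 : 0 ≤ (1 + δ⁻¹) * (c * quad P₁ x₁) := by positivity
    have f6 : (1 + δ⁻¹) * quad P₂ (H *ᵥ x₁) ≤ (1 + δ⁻¹) * (c * quad P₁ x₁) := by gcongr
    have f7 : (1 + δ⁻¹) * (c * quad P₁ x₁) = K * δ * quad P₁ x₁ := by rw [hKδ]; ring
    have f8 : (1 + δ) * quad P₂ (A₂ *ᵥ x₂) ≤ (σ + δ) * quad P₂ x₂ := by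
      have : (1 + δ) * quad P₂ (A₂ *ᵥ x₂) ≤ (1 + δ) * (σ * quad P₂ x₂) := by gcongr
      have h3 : δ * σ * quad P₂ x₂ ≤ δ * 1 * quad P₂ x₂ := by gcongr
      linarith
    have f9 : quad P₂ (A₂ *ᵥ x₂ + H *ᵥ x₁) ≤ (σ + δ) * quad P₂ x₂ + K * δ * quad P₁ x₁ := by
      linarith
    have f10 : quad P₂ (A₂ *ᵥ x₂) ≤ (σ + δ) * quad P₂ x₂ + K * δ * quad P₁ x₁ := by
      have := mul_nonneg hδ0.le g0
      linarith
    have f11 := mul_le_mul_of_nonneg_left f10 h0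
    have f12 := mul_le_mul_of_nonneg_left f9 (sub_nonneg.2 h1)
    have f13 := mul_le_mul_of_nonneg_left (f1.trans f5) hK0.le
    linarith

end Sufficiency

end LossyControl

/-! ### The equivalence -/

open LossyControl

theorem proposition1 {n : ℕ} (A : Matrix (Fin n) (Fin n) ℝ) (B : Matrix (Fin n) (Fin 1) ℝ)
    (hAB : LossyControl.IsControllable A B) (hA : LossyControl.IsUnstable A)
    {Ω : Type*} [MeasurableSpace Ω] (μ : Measure Ω) [IsProbabilityMeasure μ]
    (α₂ : ℝ) (θ₂ : ℕ → Ω → ℝ) (hθ : LossyControl.IsLossProcess μ α₂ θ₂) :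
    (∃ F : Matrix (Fin 1) (Fin n) ℝ, LossyControl.StochasticallyStable μ A B F θ₂) ↔
      α₂ < 1 / LossyControl.unstableProd A := by
  have h0 := hθ.nonneg
  have h1 := hθ.le_one
  obtain ⟨r, s, C₁, D₁, D₂, A₁, A₂, hC, hD₁, hD₂, hDC, hD, hsplit, he₁, he₂⟩ :=
    -- The closed half-line sends the unit circle to A₁ and leaves A₂ strictly stable.
    exists_spectral_split A (Set.Ici 1)
  have he₂' : ∀ z ∈ eigenvalues A₂, ‖z‖ < 1 := fun z hz => not_le.1 (he₂ z hz)
  have hprod := unstableProd_eq_det_sq hsplit he₁ he₂'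
  have hM := one_lt_unstableProd hA
  have hM0 : 0 < unstableProd A := one_pos.trans hM
  rw [lt_div_iff₀ hM0]
  simp_rw [stochasticallyStable_iff_summable hθ]
  have hctrl : ∀ y : Fin n → ℝ, (∀ k < n, y ⬝ᵥ A ^ k *ᵥ (fun i => B i 0) = 0) → y = 0 :=
    fun y hy => eq_zero_of_isControllable hAB y fun k hk => by
      funext j
      rw [Subsingleton.elim j 0]
      exact hy k hk
  constructor
  · rintro ⟨F, hF⟩
    rcases h0.eq_or_lt with hα | hα
    · rw [← hα, zero_mul]
      exact one_pos
    obtain ⟨P, hs, hP, hfix⟩ := exists_fixedPoint_of_summable h0 h1 hF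
    have hstep : ∀ x, quad P x = quad (meanOp α₂ A (A + B * F) P) x + quad 1 x := fun x => by
      conv_lhs => rw [hfix]
      rw [quad_add]
    have hone : ∀ x : Fin n → ℝ, x ≠ 0 → 0 < quad 1 x := fun x hx =>
      quad_pos_of_posDef Matrix.PosDef.one hx
    have hr : Nonempty (Fin r) := by
      by_contra hr
      rw [not_nonempty_iff] at hr
      rw [hprod, Matrix.det_isEmpty] at hM
      norm_num at hM
    have hC₁ : ∀ y, C₁ *ᵥ y = 0 → y = 0 := fun y hy => by
      rw [← Matrix.one_mulVec y, ← hDC, ← Matrix.mulVec_mulVec, hy, Matrix.mulVec_zero]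
    have hn : Nontrivial (Fin n → ℝ) := by
      by_contra hn
      rw [not_nontrivial_iff_subsingleton] at hn
      exact one_ne_zero (congrFun (hC₁ 1 (Subsingleton.elim _ _)) hr.some)
    have hB : (fun i => B i 0) ≠ 0 := fun hB => by
      obtain ⟨y, hy⟩ := exists_ne (0 : Fin n → ℝ)
      exact hy (hctrl y fun k _ => by rw [hB, Matrix.mulVec_zero, dotProduct_zero])
    rw [hprod]
    refine mul_det_sq_lt_one (F := F) hα h1 hC hC₁ (fun h => ?_) hB hs (fun x hx => ?_) fun x hx => ?_
    · rw [hprod, h] at hM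
      norm_num at hM
    · rw [hstep]
      exact add_pos_of_nonneg_of_pos (quad_meanOp_nonneg h0 h1 A _ hP x) (hone x hx)
    · linarith [hstep x, hone x hx]
  · intro hα
    rw [hprod] at hα hM
    have hpow : ∀ k, D₁ * A ^ k = A₁ ^ k * D₁ := fun k => by
      induction k with
      | zero => simp
      | succ k ih => rw [pow_succ, ← Matrix.mul_assoc, ih, Matrix.mul_assoc, hD₁,
          ← Matrix.mul_assoc, ← pow_succ]
    -- Controllability passes to the first block by pulling functionals back along D₁; the horizon
    -- stays n, not the block size.
    have hb₁ : ∀ y, (∀ k < n, y ⬝ᵥ A₁ ^ k *ᵥ (fun i => (D₁ * B) i 0) = 0) → y = 0 :=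
      fun y hy => by
        have hD₁y : y ᵥ* D₁ = 0 := hctrl _ fun k hk => by
          rw [← Matrix.dotProduct_mulVec, Matrix.mulVec_mulVec, hpow, ← Matrix.mulVec_mulVec]
          exact hy k hk
        rw [← Matrix.vecMul_one y, ← hDC, ← Matrix.vecMul_vecMul, hD₁y, Matrix.zero_vecMul]
    obtain ⟨ρ₁, P₁, F₁, hρ₁, hρ₁', -, hP₁, hL₁⟩ := exists_gain_of_one_le he₁ hb₁ hM hα
    obtain ⟨ρ₂, P₂, hρ₂, hs₂, hP₂, hL₂⟩ := exists_contraction_of_stable he₂'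
    -- Feedback from D₁x alone makes the loop a cascade, the stable block being driven through
    -- D₂BF₁.
    obtain ⟨ρ, P, hρ0, hρ, hP, hL⟩ := exists_contraction_cascade (G := A + B * (F₁ * D₁))
      (H := D₂ * B * F₁) h0 h1 hρ₁ hρ₁' hρ₂ hD₁ hD₂
      (by rw [Matrix.mul_add, Matrix.add_mul, hD₁]; simp only [Matrix.mul_assoc])
      (by rw [Matrix.mul_add, hD₂]; simp only [Matrix.mul_assoc]) hD hP₁ hs₂ hP₂ hL₁ hL₂
    exact ⟨F₁ * D₁, summable_of_contraction h0 h1 hρ0 hρ hP hL⟩
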